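/- Let $U\subset\mathbb{R}^2$ be open and let $f\colon U\to\mathbb{R}^3$ be a $C^\infty$ regular surface (immersion) without umbilic points, with smooth unit normal $\nu$ and smooth principal curvature functions $\kappa_1\neq\kappa_2$ on $U$ (so that $d\nu(w_i)=-\kappa_i\,df(w_i)$ for some $w_i\ne0$). Let $p\in U$ with $\kappa_1(p)\neq 0$ and put $t=1/\kappa_1(p)$. Let $f^t=f+t\nu$ be the parallel surface, $S(f^t)$ the set of points where $f^t$ is not an immersion, $K^t$ the Gaussian curvature of $f^t$ (defined on $U\setminus S(f^t)$), and $C_1=f+\frac1{\kappa_1}\nu$ (defined where $\kappa_1\ne0$) the focal surface. Suppose that $f^t$ is a cuspidal lips (resp. cuspidal beaks) at $p$, that is, the germ of $f^t$ at $p$ is equivalent, under smooth diffeomorphism germs of source and target, to the germ at the origin of $(u,v)\mapsto(u,2v^3+u^2v,3v^4+u^2v^2)$ (resp. $(u,v)\mapsto(u,2v^3-u^2v,3v^4-u^2v^2)$). 1. If $K^t$ is rationally bounded at $p$, then the singular curvature of $C_1$ at $p$ is defined and is positive (resp. negative). 2. If $K^t$ is bounded near $p$, i.e. bounded on $V\setminus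 S(f^t)$ for some neighbourhood $V\subset U$ of $p$, then the singular curvature of $C_1$ at $p$ is defined and is positive (resp. negative). Here a function is rationally bounded at $p$ if near $p$, on its domain, it is a quotient $h_1/h_2$ of $C^\infty$ functions defined near $p$, with $h_2\neq0$ on that domain, that have the same finite order at $p$; the order of a smooth germ $h$ at $p$ is the integer $n\ge 0$ with $h\in\mathcal{M}_p^n\setminus\mathcal{M}_p^{n+1}$, where $\mathcal{M}_p$ is the maximal ideal of the ring of $C^\infty$ function germs at $p$ (and $\mathcal{M}_p^0$ is the whole ring). A map $F$ is a front near $p$ with unit normal $n$ if $F$ and $n$ are smooth near $p$, $|n|=1$, $\langle dF(w),n\rangle=0$ for all $w$, and $(F,n)$ is an immersion; put $\lambda=\det(F_u,F_v,n)$. If $\gamma$ is a regular curve of singular points of $F$ with $\gamma(0)=p$, $\eta$ is a smooth non-vanishing vector field near $p$ with $dF_q(\eta_q)=0$ at the singular points $q$ of $F$ near $p$, and $\eta\lambda(p)\neq0$, then the singular curvature of $F$ at $p$ is $$\kappa_s=\operatorname{sgn}\bigl(\eta\lambda\cdot\det(\gamma',\eta)\bigr)\,\frac{\det(\hat\gamma',\hat\gamma'',n)}{|\hat\gamma'|^3}\Big|_{0},\qquad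 \hat\gamma=F\circ\gamma .$$ "Defined" means that such $n,\gamma,\eta$ exist, and the sign holds for every choice of them. -/

import Mathlib

open Filter Topology
open scoped ContDiff

noncomputable section

namespace FocalSurface

/-- The parameter plane, with coordinates `(u, v)`. -/
abbrev Plane : Type := ℝ × ℝ

/-- Euclidean 3-space. -/
abbrev Space : Type := EuclideanSpace ℝ (Fin 3)

/-- The determinant of three vectors of Euclidean 3-space. -/
def det3 (a b c : Space) : ℝ :=
  Matrix.det (Matrix.of ![a.ofLp, b.ofLp, c.ofLp])

/-- The determinant of two vectors of the parameter plane. -/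
def det2 (a b : Plane) : ℝ := a.1 * b.2 - a.2 * b.1

/-- The partial derivative `F_u`. -/
def du (F : Plane → Space) (q : Plane) : Space := fderiv ℝ F q (1, 0)

/-- The partial derivative `F_v`. -/
def dv (F : Plane → Space) (q : Plane) : Space := fderiv ℝ F q (0, 1)

/-- The set of points at which `F` is not an immersion. -/
def singularSet (F : Plane → Space) : Set Plane :=
  {q | ¬ Function.Injective (fderiv ℝ F q)}

/-! ### Surfaces and fronts -/

/-- `n` is a smooth unit normal vector field of the smooth map `F` on the open set `U`. -/
structure IsUnitNormal (U : Set Plane) (F n : Plane → Space) : Prop where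
  isOpen : IsOpen U
  smooth : ContDiffOn ℝ ∞ F U
  smooth_normal : ContDiffOn ℝ ∞ n U
  norm_eq_one : ∀ q ∈ U, ‖n q‖ = 1
  orthogonal : ∀ q ∈ U, ∀ w : Plane, inner ℝ (fderiv ℝ F q w) (n q) = 0

/-- A regular surface (immersion) `f` on the open set `U` with unit normal `ν`. -/
structure IsRegularSurface (U : Set Plane) (f ν : Plane → Space) : Prop
    extends IsUnitNormal U f ν where
  immersion : ∀ q ∈ U, Function.Injective (fderiv ℝ f q)

/-- A front `F` on the open set `U` with unit normal `n`: the pair `(F, n)` is an immersion. -/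
structure IsFront (U : Set Plane) (F n : Plane → Space) : Prop
    extends IsUnitNormal U F n where
  immersion : ∀ q ∈ U, Function.Injective (fderiv ℝ (fun x => (F x, n x)) q)

/-- `k` is a principal curvature of `f` (with unit normal `ν`) at `q`: an eigenvalue of the
shape operator, i.e. `dν(w) = -k df(w)` for some nonzero tangent vector `w`. -/
def IsPrincipalCurvatureAt (f ν : Plane → Space) (q : Plane) (k : ℝ) : Prop :=
  ∃ w : Plane, w ≠ 0 ∧ fderiv ℝ ν q w = -k • fderiv ℝ f q w

/-- `κ₁`, `κ₂` are the two principal curvature functions of a surface without umbilic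
points on `U`. -/
structure ArePrincipalCurvatures (U : Set Plane) (f ν : Plane → Space)
    (κ₁ κ₂ : Plane → ℝ) : Prop where
  smooth₁ : ContDiffOn ℝ ∞ κ₁ U
  smooth₂ : ContDiffOn ℝ ∞ κ₂ U
  principal₁ : ∀ q ∈ U, IsPrincipalCurvatureAt f ν q (κ₁ q)
  principal₂ : ∀ q ∈ U, IsPrincipalCurvatureAt f ν q (κ₂ q)
  no_umbilic : ∀ q ∈ U, κ₁ q ≠ κ₂ q

/-- The parallel surface at distance `t`. -/
def parallelSurface (f ν : Plane → Space) (t : ℝ) (q : Plane) : Space := f q + t • ν q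

/-- The focal surface `f + κ⁻¹ ν` (meaningful where `κ ≠ 0`). -/
def focalSurface (f ν : Plane → Space) (κ : Plane → ℝ) (q : Plane) : Space :=
  f q + (κ q)⁻¹ • ν q

/-- The Gaussian curvature `(LN - M²) / (EG - F²)` of `F` with unit normal `n`
(meaningful at the points where `F` is an immersion). -/
def gaussianCurvature (F n : Plane → Space) (q : Plane) : ℝ :=
  ((-inner ℝ (du F q) (du n q)) * (-inner ℝ (dv F q) (dv n q))
      - (-inner ℝ (du F q) (dv n q)) ^ 2) /
    (inner ℝ (du F q) (du F q) * inner ℝ (dv F q) (dv F q) - (inner ℝ (du F q) (dv F q)) ^ 2)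

/-! ### `𝒜`-equivalence, cuspidal lips and cuspidal beaks -/

/-- The map germs `F` at `p` and `G` at `q` are `𝒜`-equivalent. -/
def AEquivalent (F : Plane → Space) (p : Plane) (G : Plane → Space) (q : Plane) : Prop :=
  ∃ (φ : OpenPartialHomeomorph Plane Plane) (Φ : OpenPartialHomeomorph Space Space),
    p ∈ φ.source ∧ φ p = q ∧
    ContDiffOn ℝ ∞ φ φ.source ∧ ContDiffOn ℝ ∞ φ.symm φ.target ∧
    F p ∈ Φ.source ∧ Φ (F p) = G q ∧
    ContDiffOn ℝ ∞ Φ Φ.source ∧ ContDiffOn ℝ ∞ Φ.symm Φ.target ∧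
    ∀ᶠ x in 𝓝 p, Φ (F x) = G (φ x)

/-- `F` is a cuspidal lips at `p`. -/
def IsCuspidalLips (F : Plane → Space) (p : Plane) : Prop :=
  AEquivalent F p
    (fun x => !₂[x.1, 2 * x.2 ^ 3 + x.1 ^ 2 * x.2, 3 * x.2 ^ 4 + x.1 ^ 2 * x.2 ^ 2]) 0

/-- `F` is a cuspidal beaks at `p`. -/
def IsCuspidalBeaks (F : Plane → Space) (p : Plane) : Prop :=
  AEquivalent F p
    (fun x => !₂[x.1, 2 * x.2 ^ 3 - x.1 ^ 2 * x.2, 3 * x.2 ^ 4 - x.1 ^ 2 * x.2 ^ 2]) 0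

/-! ### Order and rational order of function germs -/

/-- `h` is smooth on a neighbourhood of `p`. -/
def SmoothNear (h : Plane → ℝ) (p : Plane) : Prop := ∀ᶠ q in 𝓝 p, ContDiffAt ℝ ∞ h q

/-- The ring of germs at `p` of smooth functions. -/
def smoothGerms (p : Plane) : Subring (Germ (𝓝 p) ℝ) where
  carrier := {g | ∃ h : Plane → ℝ, SmoothNear h p ∧ g = (h : Germ (𝓝 p) ℝ)}
  mul_mem' := by
    rintro _ _ ⟨a, ha, rfl⟩ ⟨b, hb, rfl⟩
    exact ⟨a * b, (ha.and hb).mono fun q hq => hq.1.mul hq.2, rfl⟩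
  one_mem' := ⟨1, Eventually.of_forall fun _ => contDiffAt_const, rfl⟩
  add_mem' := by
    rintro _ _ ⟨a, ha, rfl⟩ ⟨b, hb, rfl⟩
    exact ⟨a + b, (ha.and hb).mono fun q hq => hq.1.add hq.2, rfl⟩
  zero_mem' := ⟨0, Eventually.of_forall fun _ => contDiffAt_const, rfl⟩
  neg_mem' := by
    rintro _ ⟨a, ha, rfl⟩
    exact ⟨-a, ha.mono fun q hq => hq.neg, rfl⟩

/-- The germ at `p` of a function that is smooth near `p`. -/
def toGerm {h : Plane → ℝ} {p : Plane} (hh : SmoothNear h p) : smoothGerms p :=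
  ⟨(h : Germ (𝓝 p) ℝ), h, hh, rfl⟩

/-- The maximal ideal of the germs that vanish at `p`. -/
def maxIdeal (p : Plane) : Ideal (smoothGerms p) :=
  RingHom.ker ((Germ.valueRingHom : Germ (𝓝 p) ℝ →+* ℝ).comp (smoothGerms p).subtype)

/-- The germ `g` has order `n`: it lies in the `n`-th but not in the `(n+1)`-st power of the
maximal ideal. -/
def HasOrder {p : Plane} (g : smoothGerms p) (n : ℕ) : Prop :=
  g ∈ maxIdeal p ^ n ∧ g ∉ maxIdeal p ^ (n + 1)

/-- The function `g`, with domain `D`, has (finite) rational order `m` at `p`: near `p` it is a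
quotient `h₁ / h₂` of smooth functions of finite order, and `m = ord h₁ - ord h₂`. -/
def HasRationalOrder (D : Set Plane) (g : Plane → ℝ) (p : Plane) (m : ℤ) : Prop :=
  ∃ (h₁ h₂ : Plane → ℝ) (s₁ : SmoothNear h₁ p) (s₂ : SmoothNear h₂ p) (n₁ n₂ : ℕ),
    (∀ᶠ q in 𝓝 p, q ∈ D → h₂ q ≠ 0 ∧ g q = h₁ q / h₂ q) ∧
    HasOrder (toGerm s₁) n₁ ∧ HasOrder (toGerm s₂) n₂ ∧ m = (n₁ : ℤ) - n₂

/-- The function `g`, with domain `D`, is rationally bounded at `p`. -/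
def RationallyBounded (D : Set Plane) (g : Plane → ℝ) (p : Plane) : Prop :=
  HasRationalOrder D g p 0

/-- The function `g`, with domain `D`, is bounded near `p`. -/
def BoundedNear (D : Set Plane) (g : Plane → ℝ) (p : Plane) : Prop :=
  ∃ C : ℝ, ∀ᶠ q in 𝓝 p, q ∈ D → |g q| ≤ C

/-! ### The singular curvature -/

/-- The signed area density function `det (F_u, F_v, n)`. -/
def signedArea (F n : Plane → Space) (q : Plane) : ℝ := det3 (du F q) (dv F q) (n q)

/-- Data from which the singular curvature of `F` at `p` is computed: `F` is a front near `p`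
with unit normal `n`, `γ` is a regular curve of singular points with `γ 0 = p`, `η` is a null
vector field, and `ηλ(p) ≠ 0` for the signed area density `λ`. -/
structure IsSingularData (F : Plane → Space) (p : Plane) (n : Plane → Space)
    (γ : ℝ → Plane) (η : Plane → Plane) : Prop where
  front : ∃ V : Set Plane, p ∈ V ∧ IsFront V F n
  curve_smooth : ∀ᶠ s in 𝓝 (0 : ℝ), ContDiffAt ℝ ∞ γ s
  curve_zero : γ 0 = p
  curve_regular : deriv γ 0 ≠ 0
  curve_singular : ∀ᶠ s in 𝓝 (0 : ℝ), γ s ∈ singularSet F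
  null_smooth : ∀ᶠ q in 𝓝 p, ContDiffAt ℝ ∞ η q
  null_ne_zero : ∀ᶠ q in 𝓝 p, η q ≠ 0
  null : ∀ᶠ q in 𝓝 p, q ∈ singularSet F → fderiv ℝ F q (η q) = 0
  transverse : fderiv ℝ (signedArea F n) (γ 0) (η (γ 0)) ≠ 0

/-- The singular curvature at `γ 0`, i.e.
`sgn(ηλ · det(γ', η)) det(c', c'', n) / |c'|³` with `c = F ∘ γ`. -/
def singularCurvature (F n : Plane → Space) (γ : ℝ → Plane) (η : Plane → Plane) : ℝ :=
  Real.sign (fderiv ℝ (signedArea F n) (γ 0) (η (γ 0)) * det2 (deriv γ 0) (η (γ 0))) *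
    (det3 (deriv (F ∘ γ) 0) (deriv (deriv (F ∘ γ)) 0) (n (γ 0)) / ‖deriv (F ∘ γ) 0‖ ^ 3)

/-- The singular curvature of `F` at `p` is defined and positive (for every choice of the unit
normal, the singular curve and the null vector field). -/
def SingularCurvaturePos (F : Plane → Space) (p : Plane) : Prop :=
  (∃ n γ η, IsSingularData F p n γ η) ∧
    ∀ n γ η, IsSingularData F p n γ η → 0 < singularCurvature F n γ η

/-- The singular curvature of `F` at `p` is defined and negative (for every choice of the unit
normal, the singular curve and the null vector field). -/
def SingularCurvatureNeg (F : Plane → Space) (p : Plane) : Prop :=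
  (∃ n γ η, IsSingularData F p n γ η) ∧
    ∀ n γ η, IsSingularData F p n γ η → singularCurvature F n γ η < 0

end FocalSurface

end

/-! Put `ρ = 1/κ₁` and let `σ = 1` for lips, `σ = -1` for beaks. The claim is that the singular
curvature of `C₁ = f + ρν` has the sign of `σ`, and this sign is read off the Hessian of `ρ` at `p`.

The normal form has differential `du X + (σu² + 6v²) dv Y`, so `f^t` has differential `da X + (σa² +
6b²) db Y` in local coordinates `(a, b)` (`AEquivalent.exists_fderiv_eq`). Its signed area is also
that of `f` times `(1 - tκ₁)(1 - tκ₂)`, and `1 - tκ₂` does not vanish at `p`. Comparing the two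
gives `ρ = t + c(σa² + 6b²)` with `c(p) ≠ 0`, and the first principal direction `W` satisfies `da(W)
= 0` at `p` (`exists_morseForm`).

Since `K^t = κ₁κ₂ / ((1 - tκ₁)(1 - tκ₂))` and the denominator vanishes at `p`, either boundedness
hypothesis forces `κ₂(p) = 0`. This is the only use of the hypothesis; it makes the second principal
vector `y` satisfy `dν(y) = 0` at `p`.

For the focal surface, `dC₁(W) = (Wρ)ν`. Near `p` its singular set is `Wρ = 0`, a regular curve `γ`
with `db(γ') = 0` at `p`, and `W` is a null field. Because `dν(y) = 0`, the `ν`-component of `(C₁ ∘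
γ)''` is exactly the Hessian term `2σc da(γ')²` (`FocalFrame.inner_deriv_deriv`), while the
derivative of the signed area along `W` carries `12c db(W)²` (`FocalFrame.fderiv_signedArea`). In
the singular curvature all other factors combine into squares and only the sign of `σ` remains
(`FocalFrame.singularCurvature_pos`). -/

namespace FocalSurface

/-! ### Linear algebra in the plane and in space -/

lemma clm_plane_apply {E : Type*} [AddCommGroup E] [Module ℝ E] [TopologicalSpace E]
    (L : Plane →L[ℝ] E) (w : Plane) : L w = w.1 • L (1, 0) + w.2 • L (0, 1) := by
  rw [← map_smul, ← map_smul, ← map_add]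
  simp

lemma exists_smul_of_det2_eq_zero {a b : Plane} (ha : a ≠ 0) (h : det2 a b = 0) :
    ∃ s : ℝ, b = s • a := by
  unfold det2 at h
  by_cases h1 : a.1 = 0
  · have h2 : a.2 ≠ 0 := fun h2 => ha (Prod.ext h1 h2)
    have h3 : b.1 = 0 := by simpa [h1, h2] using h
    exact ⟨b.2 / a.2, Prod.ext (by simp [h1, h3]) (by simp [h2])⟩
  · refine ⟨b.1 / a.1, Prod.ext (by simp [h1]) ?_⟩
    simp only [Prod.smul_snd, smul_eq_mul]
    field_simp
    linarith

lemma exists_comb_of_det2_ne_zero {a b : Plane} (h : det2 a b ≠ 0) (x : Plane) :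
    ∃ r s : ℝ, x = r • a + s • b := by
  refine ⟨det2 x b / det2 a b, det2 a x / det2 a b, Prod.ext ?_ ?_⟩ <;>
    simp only [Prod.fst_add, Prod.snd_add, Prod.smul_fst, Prod.smul_snd, smul_eq_mul] <;>
    field_simp <;> unfold det2 <;> ring

lemma det3_eq (a b c : Space) : det3 a b c =
    a 0 * b 1 * c 2 - a 0 * b 2 * c 1 - a 1 * b 0 * c 2 + a 1 * b 2 * c 0 +
      a 2 * b 0 * c 1 - a 2 * b 1 * c 0 := by
  simp [det3, Matrix.det_fin_three]

lemma inner_space_eq (a b : Space) :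
    inner ℝ a b = a 0 * b 0 + a 1 * b 1 + a 2 * b 2 := by
  simp [PiLp.inner_apply, Fin.sum_univ_three, mul_comm]

lemma det3_comb (a b c : Space) (x y z w : ℝ) :
    det3 (x • a + y • b) (z • a + w • b) c = (x * w - y * z) * det3 a b c := by
  simp only [det3_eq, PiLp.add_apply, PiLp.smul_apply, smul_eq_mul]
  ring

/-- The square of a determinant is the Gram determinant. -/
lemma det3_sq (a b c : Space) : det3 a b c ^ 2 =
    inner ℝ a a * inner ℝ b b * inner ℝ c c + 2 * inner ℝ a b * inner ℝ b c * inner ℝ a c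
      - inner ℝ a a * inner ℝ b c ^ 2 - inner ℝ b b * inner ℝ a c ^ 2
      - inner ℝ c c * inner ℝ a b ^ 2 := by
  simp only [det3_eq, inner_space_eq]
  ring

lemma det3_smul (a b c : Space) (x y : ℝ) :
    det3 (x • a) (y • b) c = x * y * det3 a b c := by
  simp only [det3_eq, PiLp.smul_apply, smul_eq_mul]
  ring

lemma det3_apply_comb (L : Plane →L[ℝ] Space) (x y : Plane) (c : Space) :
    det3 (L x) (L y) c = det2 x y * det3 (L (1, 0)) (L (0, 1)) c := by
  rw [clm_plane_apply L x, clm_plane_apply L y, det3_comb]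
  rfl

/-- If `m` is a unit vector orthogonal to `a` and `c`, only the `m`-component of `b`
contributes to `det (a, b, c)`. -/
lemma det3_eq_of_orthogonal {a c m : Space} (b : Space) (hm : ‖m‖ = 1)
    (ha : inner ℝ a m = 0) (hc : inner ℝ c m = 0) :
    det3 a b c = -(inner ℝ b m * det3 m a c) := by
  have hmm : inner ℝ m m = (1 : ℝ) := by rw [real_inner_self_eq_norm_sq, hm]; norm_num
  -- After removing the `m`-component of `b`, all three rows are orthogonal to `m`, so the matrix
  -- kills `m`.
  have key : det3 a (b - inner ℝ b m • m) c = 0 := by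
    apply Matrix.exists_mulVec_eq_zero_iff.1
    refine ⟨m.ofLp, fun h => ?_, ?_⟩
    · have : m = 0 := by ext i; simpa using congrFun h i
      simp [this] at hm
    · have hb : inner ℝ (b - inner ℝ b m • m) m = (0 : ℝ) := by
        rw [inner_sub_left, real_inner_smul_left, hmm]; ring
      rw [inner_space_eq] at ha hb hc
      ext i
      fin_cases i <;> simpa [Matrix.mulVec, dotProduct, Fin.sum_univ_three]
  have : det3 a (b - inner ℝ b m • m) c = det3 a b c + inner ℝ b m * det3 m a c := by
    simp only [det3_eq, PiLp.sub_apply, PiLp.smul_apply, smul_eq_mul]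
    ring
  linarith

/-- By `det3_sq` the squared determinant is `|a|²|b|² - ⟨a,b⟩²`. If it vanishes, `|b|² a - ⟨a,b⟩ b`
has norm zero, which is a linear relation. -/
lemma det3_ne_zero_of_orthogonal {a b m : Space} (hm : ‖m‖ = 1) (ha : inner ℝ a m = 0)
    (hb : inner ℝ b m = 0) (hab : LinearIndependent ℝ ![a, b]) : det3 a b m ≠ 0 := by
  intro h
  have hs := det3_sq a b m
  have hmm : inner ℝ m m = (1 : ℝ) := by rw [real_inner_self_eq_norm_sq, hm]; norm_num
  rw [h, hmm, ha, hb] at hs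
  have hz : inner ℝ (inner ℝ b b • a - inner ℝ a b • b) (inner ℝ b b • a - inner ℝ a b • b)
      = (0 : ℝ) := by
    simp only [inner_sub_left, inner_sub_right, real_inner_smul_left, real_inner_smul_right,
      real_inner_comm a b]
    linear_combination (-inner ℝ b b) * hs
  have hz' := inner_self_eq_zero.1 hz
  have := (LinearIndependent.pair_iff.1 hab) (inner ℝ b b) (-inner ℝ a b)
    (by rw [neg_smul, ← sub_eq_add_neg]; exact hz')
  have hb0 := inner_self_eq_zero.1 this.1
  exact hab.ne_zero 1 hb0

lemma linearIndependent_pair_apply {L : Plane →L[ℝ] Space} (hL : Function.Injective L)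
    {x y : Plane} (h : det2 x y ≠ 0) : LinearIndependent ℝ ![L x, L y] := by
  rw [LinearIndependent.pair_iff]
  intro r s hrs
  rw [← map_smul, ← map_smul, ← map_add, map_eq_zero_iff L hL] at hrs
  have h1 := congrArg Prod.fst hrs
  have h2 := congrArg Prod.snd hrs
  simp only [Prod.fst_add, Prod.snd_add, Prod.smul_fst, Prod.smul_snd, smul_eq_mul,
    Prod.fst_zero, Prod.snd_zero] at h1 h2
  unfold det2 at h
  constructor
  · refine (mul_eq_zero.1 ?_).resolve_right h
    linear_combination y.2 * h1 - y.1 * h2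
  · refine (mul_eq_zero.1 ?_).resolve_right h
    linear_combination x.1 * h2 - x.2 * h1

lemma contDiffAt_det3 {E : Type*} [NormedAddCommGroup E] [NormedSpace ℝ E]
    {a b c : E → Space} {q : E} {k : WithTop ℕ∞} (ha : ContDiffAt ℝ k a q)
    (hb : ContDiffAt ℝ k b q) (hc : ContDiffAt ℝ k c q) :
    ContDiffAt ℝ k (fun x => det3 (a x) (b x) (c x)) q := by
  have ha' := contDiffAt_euclidean.1 ha
  have hb' := contDiffAt_euclidean.1 hb
  have hc' := contDiffAt_euclidean.1 hc
  simp only [det3_eq]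
  exact (((((((ha' 0).mul (hb' 1)).mul (hc' 2)).sub (((ha' 0).mul (hb' 2)).mul (hc' 1))).sub
    (((ha' 1).mul (hb' 0)).mul (hc' 2))).add (((ha' 1).mul (hb' 2)).mul (hc' 0))).add
    (((ha' 2).mul (hb' 0)).mul (hc' 1))).sub (((ha' 2).mul (hb' 1)).mul (hc' 0))

lemma _root_.ContDiffAt.fderiv_top {E F : Type*} [NormedAddCommGroup E] [NormedSpace ℝ E]
    [NormedAddCommGroup F] [NormedSpace ℝ F] {f : E → F} {q : E} (hf : ContDiffAt ℝ ∞ f q) :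
    ContDiffAt ℝ ∞ (fderiv ℝ f) q :=
  hf.fderiv_right (by simp)

lemma _root_.ContDiffAt.differentiableAt_top {E F : Type*} [NormedAddCommGroup E]
    [NormedSpace ℝ E] [NormedAddCommGroup F] [NormedSpace ℝ F] {f : E → F} {q : E}
    (hf : ContDiffAt ℝ ∞ f q) : DifferentiableAt ℝ f q :=
  hf.differentiableAt (by simp)

/-! ### Unit normals and principal directions -/

namespace IsUnitNormal

variable {U : Set Plane} {F n : Plane → Space} {q : Plane}

lemma contDiffAt (h : IsUnitNormal U F n) (hq : q ∈ U) : ContDiffAt ℝ ∞ F q :=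
  h.smooth.contDiffAt (h.isOpen.mem_nhds hq)

lemma contDiffAt_normal (h : IsUnitNormal U F n) (hq : q ∈ U) : ContDiffAt ℝ ∞ n q :=
  h.smooth_normal.contDiffAt (h.isOpen.mem_nhds hq)

lemma inner_fderiv_normal (h : IsUnitNormal U F n) (hq : q ∈ U) (x : Plane) :
    inner ℝ (fderiv ℝ n q x) (n q) = 0 := by
  have hd := (h.contDiffAt_normal hq).differentiableAt_top
  have h1 : (fun y => inner ℝ (n y) (n y)) =ᶠ[𝓝 q] fun _ => (1 : ℝ) := by
    filter_upwards [h.isOpen.mem_nhds hq] with y hy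
    rw [real_inner_self_eq_norm_sq, h.norm_eq_one y hy]; norm_num
  have h2 := congrArg (fun L : Plane →L[ℝ] ℝ => L x) h1.fderiv_eq
  rw [fderiv_inner_apply ℝ hd hd] at h2
  simp only [fderiv_fun_const, Pi.zero_apply, zero_apply] at h2
  rw [real_inner_comm] at h2
  linarith

/-- Symmetry of the second fundamental form. -/
lemma inner_fderiv_symm (h : IsUnitNormal U F n) (hq : q ∈ U) (x y : Plane) :
    inner ℝ (fderiv ℝ F q x) (fderiv ℝ n q y) = inner ℝ (fderiv ℝ F q y) (fderiv ℝ n q x) := by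
  have hdn := (h.contDiffAt_normal hq).differentiableAt_top
  have hdF := (h.contDiffAt hq).fderiv_top.differentiableAt_top
  -- Differentiate `⟨dF(a), n⟩ = 0` along `b`; the claim then reduces to the symmetry of the second
  -- derivative.
  have key : ∀ a b : Plane, inner ℝ (fderiv ℝ F q a) (fderiv ℝ n q b) =
      -inner ℝ (fderiv ℝ (fderiv ℝ F) q b a) (n q) := by
    intro a b
    have h1 : (fun z => inner ℝ (fderiv ℝ F z a) (n z)) =ᶠ[𝓝 q] fun _ => (0 : ℝ) := by
      filter_upwards [h.isOpen.mem_nhds hq] with z hz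
      exact h.orthogonal z hz a
    have h2 := congrArg (fun L : Plane →L[ℝ] ℝ => L b) h1.fderiv_eq
    rw [fderiv_inner_apply ℝ (hdF.clm_apply (differentiableAt_const a)) hdn,
      fderiv_clm_apply hdF (differentiableAt_const a)] at h2
    simp at h2
    linarith
  have hs : IsSymmSndFDerivAt ℝ F q :=
    (h.contDiffAt hq).isSymmSndFDerivAt
      (by simp only [minSmoothness_of_isRCLikeNormedField]; exact WithTop.coe_le_coe.2 le_top)
  rw [key, key, hs.eq]

end IsUnitNormal

/-- Eigenvectors of the self-adjoint shape operator for distinct eigenvalues are orthogonal.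
Orthogonal nonzero images under an injective differential cannot come from parallel vectors. -/
lemma IsRegularSurface.principal_basis {U : Set Plane} {f ν : Plane → Space}
    (hf : IsRegularSurface U f ν) {q : Plane} (hq : q ∈ U) {k l : ℝ} (hkl : k ≠ l)
    {x y : Plane} (hx : x ≠ 0) (hy : y ≠ 0) (hxk : fderiv ℝ ν q x = -k • fderiv ℝ f q x)
    (hyl : fderiv ℝ ν q y = -l • fderiv ℝ f q y) :
    inner ℝ (fderiv ℝ f q x) (fderiv ℝ f q y) = 0 ∧ det2 x y ≠ 0 := by
  have horth : inner ℝ (fderiv ℝ f q x) (fderiv ℝ f q y) = 0 := by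
    have h1 := hf.inner_fderiv_symm hq x y
    rw [hxk, hyl, real_inner_smul_right, real_inner_smul_right,
      real_inner_comm (fderiv ℝ f q x)] at h1
    refine (mul_eq_zero.1 (?_ : (k - l) * _ = 0)).resolve_left (sub_ne_zero.2 hkl)
    linear_combination h1
  refine ⟨horth, fun h => ?_⟩
  obtain ⟨s, rfl⟩ := exists_smul_of_det2_eq_zero hx h
  rw [map_smul, real_inner_smul_right, mul_eq_zero] at horth
  rcases horth with h | h
  · exact hy (by simp [h])
  · rw [inner_self_eq_zero, map_eq_zero_iff _ (hf.immersion q hq)] at h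
    exact hx h

lemma IsUnitNormal.fderiv_parallelSurface {U : Set Plane} {f ν : Plane → Space}
    (hf : IsUnitNormal U f ν) {q : Plane} (hq : q ∈ U) (t : ℝ) :
    fderiv ℝ (parallelSurface f ν t) q = fderiv ℝ f q + t • fderiv ℝ ν q := by
  have h1 := (hf.contDiffAt hq).differentiableAt_top
  have h2 := (hf.contDiffAt_normal hq).differentiableAt_top
  change fderiv ℝ (f + t • ν) q = _
  rw [fderiv_add h1 (h2.const_smul t), fderiv_const_smul h2]

lemma IsUnitNormal.parallelSurface {U : Set Plane} {f ν : Plane → Space}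
    (hf : IsUnitNormal U f ν) (t : ℝ) : IsUnitNormal U (parallelSurface f ν t) ν where
  isOpen := hf.isOpen
  smooth := hf.smooth.add (hf.smooth_normal.const_smul t)
  smooth_normal := hf.smooth_normal
  norm_eq_one := hf.norm_eq_one
  orthogonal q hq w := by
    rw [hf.fderiv_parallelSurface hq]
    simp [inner_add_left, real_inner_smul_left, hf.orthogonal q hq, hf.inner_fderiv_normal hq]

/-! ### Signed area and Gaussian curvature of parallel surfaces -/

section Principal

variable {U : Set Plane} {f ν : Plane → Space} {κ₁ κ₂ : Plane → ℝ}

lemma signedArea_parallelSurface (hf : IsRegularSurface U f ν)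
    (hκ : ArePrincipalCurvatures U f ν κ₁ κ₂) (t : ℝ) {q : Plane} (hq : q ∈ U) :
    signedArea (parallelSurface f ν t) ν q =
      (1 - t * κ₁ q) * (1 - t * κ₂ q) * signedArea f ν q := by
  obtain ⟨x, hx, hxk⟩ := hκ.principal₁ q hq
  obtain ⟨y, hy, hyk⟩ := hκ.principal₂ q hq
  have hd := (hf.principal_basis hq (hκ.no_umbilic q hq) hx hy hxk hyk).2
  apply mul_left_cancel₀ hd
  unfold signedArea du dv
  rw [← det3_apply_comb, hf.fderiv_parallelSurface hq]
  have e1 : (fderiv ℝ f q + t • fderiv ℝ ν q) x = (1 - t * κ₁ q) • fderiv ℝ f q x := by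
    simp [hxk]; module
  have e2 : (fderiv ℝ f q + t • fderiv ℝ ν q) y = (1 - t * κ₂ q) • fderiv ℝ f q y := by
    simp [hyk]; module
  rw [e1, e2, det3_smul, det3_apply_comb]
  ring

lemma signedArea_ne_zero (hf : IsRegularSurface U f ν) {q : Plane} (hq : q ∈ U) :
    signedArea f ν q ≠ 0 :=
  det3_ne_zero_of_orthogonal (hf.norm_eq_one q hq) (hf.orthogonal q hq _)
    (hf.orthogonal q hq _) (linearIndependent_pair_apply (hf.immersion q hq) (by simp [det2]))

lemma not_mem_singularSet_parallelSurface (hf : IsRegularSurface U f ν)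
    (hκ : ArePrincipalCurvatures U f ν κ₁ κ₂) (t : ℝ) {q : Plane} (hq : q ∈ U)
    (h : (1 - t * κ₁ q) * (1 - t * κ₂ q) ≠ 0) :
    q ∉ singularSet (parallelSurface f ν t) := by
  rw [singularSet, Set.mem_ofPred_eq, not_not, injective_iff_map_eq_zero]
  intro x hx
  by_contra hx0
  have hA := signedArea_parallelSurface hf hκ t hq
  have hne : signedArea (parallelSurface f ν t) ν q ≠ 0 := by
    rw [hA]; exact mul_ne_zero h (signedArea_ne_zero hf hq)
  unfold signedArea du dv at hne
  -- Pairing a kernel vector `x` with its quarter turn gives `det2 = |x|²`, which a nonzero area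
  -- density forces to vanish.
  have h1 := det3_apply_comb (fderiv ℝ (parallelSurface f ν t) q) x (-x.2, x.1) (ν q)
  rw [hx] at h1
  have h2 : det2 x (-x.2, x.1) = 0 := by
    refine (mul_eq_zero.1 (h1.symm.trans ?_)).resolve_right hne
    simp [det3_eq]
  unfold det2 at h2
  simp only at h2
  refine hx0 (Prod.ext (pow_eq_zero_iff two_ne_zero |>.1 ?_) (pow_eq_zero_iff two_ne_zero |>.1 ?_))
    <;> nlinarith [sq_nonneg x.1, sq_nonneg x.2]

/-- The Gaussian curvature of the parallel surface in terms of the principal curvatures. -/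
lemma gaussianCurvature_parallelSurface (hf : IsRegularSurface U f ν)
    (hκ : ArePrincipalCurvatures U f ν κ₁ κ₂) (t : ℝ) {q : Plane} (hq : q ∈ U)
    (h : (1 - t * κ₁ q) * (1 - t * κ₂ q) ≠ 0) :
    gaussianCurvature (parallelSurface f ν t) ν q =
      κ₁ q * κ₂ q / ((1 - t * κ₁ q) * (1 - t * κ₂ q)) := by
  obtain ⟨x, hx, hxk⟩ := hκ.principal₁ q hq
  obtain ⟨y, hy, hyk⟩ := hκ.principal₂ q hq
  obtain ⟨ho, hd⟩ := hf.principal_basis hq (hκ.no_umbilic q hq) hx hy hxk hyk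
  set F := parallelSurface f ν t with hF
  have hsym := (hf.parallelSurface t).inner_fderiv_symm hq (1, 0) (0, 1)
  have e1 : fderiv ℝ F q x = (1 - t * κ₁ q) • fderiv ℝ f q x := by
    rw [hF, hf.fderiv_parallelSurface hq]; simp [hxk]; module
  have e2 : fderiv ℝ F q y = (1 - t * κ₂ q) • fderiv ℝ f q y := by
    rw [hF, hf.fderiv_parallelSurface hq]; simp [hyk]; module
  have ho' : inner ℝ (fderiv ℝ f q y) (fderiv ℝ f q x) = 0 := by rw [real_inner_comm, ho]
  have hX : inner ℝ (fderiv ℝ f q x) (fderiv ℝ f q x) ≠ 0 := by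
    rw [Ne, inner_self_eq_zero, map_eq_zero_iff _ (hf.immersion q hq)]; exact hx
  have hY : inner ℝ (fderiv ℝ f q y) (fderiv ℝ f q y) ≠ 0 := by
    rw [Ne, inner_self_eq_zero, map_eq_zero_iff _ (hf.immersion q hq)]; exact hy
  -- Numerator and denominator of the curvature are both `2 × 2` minors of this kind; passing to the
  -- principal basis multiplies each by `det2 x y ^ 2`, which cancels in the quotient.
  have hgen : ∀ A B : Plane →L[ℝ] Space,
      inner ℝ (A x) (B x) * inner ℝ (A y) (B y) - inner ℝ (A x) (B y) * inner ℝ (A y) (B x) =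
      det2 x y ^ 2 * (inner ℝ (A (1, 0)) (B (1, 0)) * inner ℝ (A (0, 1)) (B (0, 1)) -
        inner ℝ (A (1, 0)) (B (0, 1)) * inner ℝ (A (0, 1)) (B (1, 0))) := by
    intro A B
    rw [clm_plane_apply A x, clm_plane_apply A y, clm_plane_apply B x, clm_plane_apply B y]
    simp only [inner_add_left, inner_add_right, real_inner_smul_left, real_inner_smul_right, det2]
    ring
  have h1 := hgen (fderiv ℝ F q) (fderiv ℝ ν q)
  have h2 := hgen (fderiv ℝ F q) (fderiv ℝ F q)
  simp only [e1, e2, hxk, hyk, real_inner_smul_left, real_inner_smul_right, ho, ho'] at h1 h2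
  rw [← hsym] at h1
  rw [real_inner_comm (fderiv ℝ F q (1, 0)) (fderiv ℝ F q (0, 1))] at h2
  unfold gaussianCurvature du dv
  have hden : inner ℝ (fderiv ℝ F q (1, 0)) (fderiv ℝ F q (1, 0)) *
      inner ℝ (fderiv ℝ F q (0, 1)) (fderiv ℝ F q (0, 1)) -
      inner ℝ (fderiv ℝ F q (1, 0)) (fderiv ℝ F q (0, 1)) ^ 2 ≠ 0 := by
    intro h0
    have h0' : ((1 - t * κ₁ q) * (1 - t * κ₂ q)) ^ 2 *
      inner ℝ (fderiv ℝ f q x) (fderiv ℝ f q x) * inner ℝ (fderiv ℝ f q y) (fderiv ℝ f q y)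
        = 0 := by
      linear_combination h2 + det2 x y ^ 2 * h0
    exact mul_ne_zero (mul_ne_zero (pow_ne_zero 2 h) hX) hY h0'
  rw [div_eq_div_iff hden h]
  apply mul_left_cancel₀ (pow_ne_zero 2 hd)
  linear_combination (-((1 - t * κ₁ q) * (1 - t * κ₂ q))) * h1 + κ₁ q * κ₂ q * h2

end Principal

/-! ### The normal forms and the induced factorization -/

/-- The Jacobian determinant of the pair of functions `(a, b)`. -/
noncomputable def jac (a b : Plane → ℝ) (q : Plane) : ℝ :=
  fderiv ℝ a q (1, 0) * fderiv ℝ b q (0, 1) - fderiv ℝ a q (0, 1) * fderiv ℝ b q (1, 0)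

lemma jac_apply (a b : Plane → ℝ) (q x y : Plane) :
    fderiv ℝ a q x * fderiv ℝ b q y - fderiv ℝ a q y * fderiv ℝ b q x =
      det2 x y * jac a b q := by
  rw [clm_plane_apply (fderiv ℝ a q) x, clm_plane_apply (fderiv ℝ a q) y,
    clm_plane_apply (fderiv ℝ b q) x, clm_plane_apply (fderiv ℝ b q) y]
  simp only [smul_eq_mul, jac, det2]
  ring

lemma eq_zero_of_jac_ne_zero {a b : Plane → ℝ} {q x : Plane} (h : jac a b q ≠ 0)
    (ha : fderiv ℝ a q x = 0) (hb : fderiv ℝ b q x = 0) : x = 0 := by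
  have key : ∀ y, det2 x y = 0 := fun y => by
    refine (mul_eq_zero.1 ((jac_apply a b q x y).symm.trans ?_)).resolve_right h
    rw [ha, hb]; ring
  have h1 := key (0, 1)
  have h2 := key (1, 0)
  simp only [det2, mul_one, mul_zero, sub_zero, zero_sub, neg_eq_zero] at h1 h2
  exact Prod.ext h1 h2

lemma contDiffAt_jac {a b : Plane → ℝ} {q : Plane} (ha : ContDiffAt ℝ ∞ a q)
    (hb : ContDiffAt ℝ ∞ b q) : ContDiffAt ℝ ∞ (jac a b) q :=
  ((ha.fderiv_top.clm_apply contDiffAt_const).mul (hb.fderiv_top.clm_apply contDiffAt_const)).sub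
    ((ha.fderiv_top.clm_apply contDiffAt_const).mul (hb.fderiv_top.clm_apply contDiffAt_const))

/-- The quadratic function `σ a² + 6 b²`. -/
def quad (σ : ℝ) (a b : Plane → ℝ) (q : Plane) : ℝ := σ * a q ^ 2 + 6 * b q ^ 2

lemma hasFDerivAt_quad (σ : ℝ) {a b : Plane → ℝ} {q : Plane} (ha : DifferentiableAt ℝ a q)
    (hb : DifferentiableAt ℝ b q) : HasFDerivAt (quad σ a b)
      ((2 * σ * a q) • fderiv ℝ a q + (12 * b q) • fderiv ℝ b q) q := by
  have h := ((ha.hasFDerivAt.pow 2).const_mul σ).add ((hb.hasFDerivAt.pow 2).const_mul 6)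
  refine h.congr_fderiv ?_
  ext <;> simp <;> ring

/-- The zero set of `σ a² + 6 b²` has no interior near a point at which `(a, b)` is a local
diffeomorphism. -/
lemma eventually_frequently_quad_ne_zero {σ : ℝ} (hσ : σ ≠ 0) {a b : Plane → ℝ} {p : Plane}
    (ha : ∀ᶠ q in 𝓝 p, ContDiffAt ℝ ∞ a q) (hb : ∀ᶠ q in 𝓝 p, ContDiffAt ℝ ∞ b q)
    (hj : jac a b p ≠ 0) : ∀ᶠ q in 𝓝 p, ∃ᶠ r in 𝓝 q, quad σ a b r ≠ 0 := by
  have hj' := (contDiffAt_jac ha.self_of_nhds hb.self_of_nhds).continuousAt.eventually_ne hj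
  filter_upwards [eventually_eventually_nhds.2 (ha.and (hb.and hj'))] with q hq
  intro hz
  have hz' : ∀ᶠ r in 𝓝 q, quad σ a b r = 0 := hz.mono fun r hr => not_not.1 hr
  -- If the quadratic vanishes near `q`, so does `2σa da + 12b db`. Independence of `da` and `db`
  -- gives `a = 0` near `q`, hence `da = 0`, contradicting the Jacobian condition.
  have ha0 : ∀ᶠ r in 𝓝 q, a r = 0 := by
    filter_upwards [hq, eventually_eventually_nhds.2 hz'] with r ⟨hra, hrb, hrj⟩ hr
    have h0 : fderiv ℝ (quad σ a b) r = 0 := by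
      rw [EventuallyEq.fderiv_eq (f := fun _ => (0 : ℝ)) hr]; simp
    rw [(hasFDerivAt_quad σ hra.differentiableAt_top hrb.differentiableAt_top).fderiv] at h0
    have h1 := congrArg (fun L : Plane →L[ℝ] ℝ => L (1, 0)) h0
    have h2 := congrArg (fun L : Plane →L[ℝ] ℝ => L (0, 1)) h0
    simp at h1 h2
    unfold jac at hrj
    have h3 : (2 * σ * a r) * (fderiv ℝ a r (1, 0) * fderiv ℝ b r (0, 1) -
        fderiv ℝ a r (0, 1) * fderiv ℝ b r (1, 0)) = 0 := by
      linear_combination (fderiv ℝ b r (0, 1)) * h1 - (fderiv ℝ b r (1, 0)) * h2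
    have h4 := (mul_eq_zero.1 h3).resolve_right hrj
    exact (mul_eq_zero.1 h4).resolve_left (by simpa using hσ)
  have h0 : fderiv ℝ a q = 0 := by
    rw [EventuallyEq.fderiv_eq (f := fun _ => (0 : ℝ)) ha0]; simp
  exact hq.self_of_nhds.2.2 (by simp [jac, h0])

/-- The normal form of the cuspidal lips (`σ = 1`) and of the cuspidal beaks (`σ = -1`). -/
def normalForm (σ : ℝ) (x : Plane) : Space :=
  !₂[x.1, 2 * x.2 ^ 3 + σ * x.1 ^ 2 * x.2, 3 * x.2 ^ 4 + σ * x.1 ^ 2 * x.2 ^ 2]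

/-- The partial derivative of the normal form with respect to `u`. -/
def normalFormU (σ : ℝ) (x : Plane) : Space :=
  !₂[1, 2 * σ * x.1 * x.2, 2 * σ * x.1 * x.2 ^ 2]

/-- The partial derivative of the normal form with respect to `v`, divided by
`σ u² + 6 v²`. -/
def normalFormV (x : Plane) : Space := !₂[0, 1, 2 * x.2]

lemma contDiff_normalForm (σ : ℝ) : ContDiff ℝ ∞ (normalForm σ) := by
  rw [contDiff_euclidean]
  intro i
  fin_cases i <;> simp [normalForm] <;> fun_prop

lemma contDiff_normalFormU (σ : ℝ) : ContDiff ℝ ∞ (normalFormU σ) := by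
  rw [contDiff_euclidean]
  intro i
  fin_cases i <;> simp [normalFormU] <;> fun_prop

lemma contDiff_normalFormV : ContDiff ℝ ∞ normalFormV := by
  rw [contDiff_euclidean]
  intro i
  fin_cases i <;> simp [normalFormV] <;> fun_prop

lemma fderiv_normalForm (σ : ℝ) (x w : Plane) : fderiv ℝ (normalForm σ) x w =
    w.1 • normalFormU σ x + (w.2 * (σ * x.1 ^ 2 + 6 * x.2 ^ 2)) • normalFormV x := by
  have hd : DifferentiableAt ℝ (normalForm σ) x :=
    (contDiff_normalForm σ).contDiffAt.differentiableAt_top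
  have hc : ∀ i, (fderiv ℝ (normalForm σ) x w) i =
      fderiv ℝ (fun y => normalForm σ y i) x w := fun i => by
    have := ((EuclideanSpace.proj (𝕜 := ℝ) i).hasFDerivAt.comp x hd.hasFDerivAt).fderiv
    exact (congrArg (fun L : Plane →L[ℝ] ℝ => L w) this).symm
  have h1 : HasFDerivAt (fun y : Plane => y.1) (ContinuousLinearMap.fst ℝ ℝ ℝ) x := hasFDerivAt_fst
  have h2 : HasFDerivAt (fun y : Plane => y.2) (ContinuousLinearMap.snd ℝ ℝ ℝ) x := hasFDerivAt_snd
  ext i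
  rw [hc]
  fin_cases i
  · simp [normalForm, normalFormU, normalFormV, h1.fderiv]
  · have h := ((h2.pow 3).const_mul 2).add (((h1.pow 2).const_mul σ).mul h2)
    have e : (fun y => normalForm σ y 1) =
      fun y : Plane => 2 * y.2 ^ 3 + σ * y.1 ^ 2 * y.2 := by ext y; simp [normalForm]
    change fderiv ℝ (fun y => normalForm σ y 1) x w = _
    rw [e]
    refine (congrArg (fun L : Plane →L[ℝ] ℝ => L w) h.fderiv).trans ?_
    simp [normalFormU, normalFormV]
    ring
  · have h := ((h2.pow 4).const_mul 3).add (((h1.pow 2).const_mul σ).mul (h2.pow 2))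
    have e : (fun y => normalForm σ y 2) =
      fun y : Plane => 3 * y.2 ^ 4 + σ * y.1 ^ 2 * y.2 ^ 2 := by ext y; simp [normalForm]
    change fderiv ℝ (fun y => normalForm σ y 2) x w = _
    rw [e]
    refine (congrArg (fun L : Plane →L[ℝ] ℝ => L w) h.fderiv).trans ?_
    simp [normalFormU, normalFormV]
    ring

/-- A map germ equivalent to a normal form has differential `da X + (σ a² + 6 b²) db Y`. -/
lemma AEquivalent.exists_fderiv_eq {σ : ℝ} {F : Plane → Space} {p : Plane}
    (h : AEquivalent F p (normalForm σ) 0) (hF : ContinuousAt F p) :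
    ∃ (a b : Plane → ℝ) (X Y : Plane → Space),
      (∀ᶠ q in 𝓝 p, ContDiffAt ℝ ∞ a q) ∧ (∀ᶠ q in 𝓝 p, ContDiffAt ℝ ∞ b q) ∧
      (∀ᶠ q in 𝓝 p, ContDiffAt ℝ ∞ X q) ∧ (∀ᶠ q in 𝓝 p, ContDiffAt ℝ ∞ Y q) ∧
      a p = 0 ∧ b p = 0 ∧ jac a b p ≠ 0 ∧ LinearIndependent ℝ ![X p, Y p] ∧
      ∀ᶠ q in 𝓝 p, ∀ w, fderiv ℝ F q w =
        fderiv ℝ a q w • X q + (fderiv ℝ b q w * quad σ a b q) • Y q := by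
  obtain ⟨φ, Φ, hpφ, hφp, hφ, hφs, hpΦ, hΦp, hΦ, hΦs, heq⟩ := h
  have hφ' : ∀ᶠ q in 𝓝 p, ContDiffAt ℝ ∞ φ q := by
    filter_upwards [φ.open_source.mem_nhds hpφ] with q hq
    exact hφ.contDiffAt (φ.open_source.mem_nhds hq)
  have h0t : normalForm σ 0 ∈ Φ.target := hΦp ▸ Φ.map_source hpΦ
  have hφc := hφ'.self_of_nhds.continuousAt
  have hGφ : ContinuousAt (fun q => normalForm σ (φ q)) p :=
    (contDiff_normalForm σ).continuous.continuousAt.comp hφc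
  have ht : ∀ᶠ q in 𝓝 p, normalForm σ (φ q) ∈ Φ.target :=
    hGφ.eventually_mem (by simpa only [hφp] using Φ.open_target.mem_nhds h0t)
  have hΨ : ∀ᶠ q in 𝓝 p, ContDiffAt ℝ ∞ Φ.symm (normalForm σ (φ q)) := by
    filter_upwards [ht] with q hq
    exact hΦs.contDiffAt (Φ.open_target.mem_nhds hq)
  have hFe : ∀ᶠ q in 𝓝 p, F q = Φ.symm (normalForm σ (φ q)) := by
    filter_upwards [heq, hF.eventually_mem (Φ.open_source.mem_nhds hpΦ)] with q hq hqs
    rw [← hq, Φ.left_inv hqs]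
  have hinjφ : Function.Injective (fderiv ℝ φ p) := by
    have h1 : ContDiffAt ℝ ∞ φ.symm (φ p) :=
      hφs.contDiffAt (φ.open_target.mem_nhds (φ.map_source hpφ))
    have h2 : (φ.symm ∘ φ) =ᶠ[𝓝 p] id := φ.eventually_left_inverse hpφ
    have h3 := h2.fderiv_eq (𝕜 := ℝ)
    rw [fderiv_comp p h1.differentiableAt_top hφ'.self_of_nhds.differentiableAt_top,
      fderiv_id] at h3
    exact Function.LeftInverse.injective (g := fderiv ℝ φ.symm (φ p))
      fun x => congrArg (fun L : Plane →L[ℝ] Plane => L x) h3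
  have hinjΨ : Function.Injective (fderiv ℝ Φ.symm (normalForm σ 0)) := by
    have h1 : ContDiffAt ℝ ∞ Φ (Φ.symm (normalForm σ 0)) :=
      hΦ.contDiffAt (Φ.open_source.mem_nhds (Φ.map_target h0t))
    have h2 : (Φ ∘ Φ.symm) =ᶠ[𝓝 (normalForm σ 0)] id := Φ.eventually_right_inverse h0t
    have h3 := h2.fderiv_eq (𝕜 := ℝ)
    have h4 : ContDiffAt ℝ ∞ Φ.symm (normalForm σ 0) := by simpa [hφp] using hΨ.self_of_nhds
    rw [fderiv_comp _ h1.differentiableAt_top h4.differentiableAt_top, fderiv_id] at h3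
    exact Function.LeftInverse.injective (g := fderiv ℝ Φ (Φ.symm (normalForm σ 0)))
      fun x => congrArg (fun L : Space →L[ℝ] Space => L x) h3
  have hfst : ∀ᶠ q in 𝓝 p, ∀ w, fderiv ℝ (fun x => (φ x).1) q w = (fderiv ℝ φ q w).1 := by
    filter_upwards [hφ'] with q hq w
    rw [fderiv.fst hq.differentiableAt_top]; rfl
  have hsnd : ∀ᶠ q in 𝓝 p, ∀ w, fderiv ℝ (fun x => (φ x).2) q w = (fderiv ℝ φ q w).2 := by
    filter_upwards [hφ'] with q hq w
    rw [fderiv.snd hq.differentiableAt_top]; rfl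
  -- The coordinates are those of the source diffeomorphism; `X` and `Y` are the columns of the
  -- normal form pushed forward by the differential of the inverse target diffeomorphism.
  refine ⟨fun q => (φ q).1, fun q => (φ q).2,
    fun q => fderiv ℝ Φ.symm (normalForm σ (φ q)) (normalFormU σ (φ q)),
    fun q => fderiv ℝ Φ.symm (normalForm σ (φ q)) (normalFormV (φ q)),
    hφ'.mono fun q hq => hq.fst, hφ'.mono fun q hq => hq.snd, ?_, ?_, by simp [hφp],
    by simp [hφp], ?_, ?_, ?_⟩
  · filter_upwards [hφ', hΨ] with q hq hqΨ
    exact (hqΨ.fderiv_top.comp q ((contDiff_normalForm σ).contDiffAt.comp q hq)).clm_apply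
      ((contDiff_normalFormU σ).contDiffAt.comp q hq)
  · filter_upwards [hφ', hΨ] with q hq hqΨ
    exact (hqΨ.fderiv_top.comp q ((contDiff_normalForm σ).contDiffAt.comp q hq)).clm_apply
      (contDiff_normalFormV.contDiffAt.comp q hq)
  · intro hj
    unfold jac at hj
    simp only [hfst.self_of_nhds, hsnd.self_of_nhds] at hj
    obtain ⟨s, hs⟩ := exists_smul_of_det2_eq_zero
      (a := fderiv ℝ φ p (1, 0)) (b := fderiv ℝ φ p (0, 1))
      (by rw [Ne, map_eq_zero_iff _ hinjφ]; simp) (by unfold det2; linarith)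
    rw [← map_smul] at hs
    simpa using hinjφ hs
  · have hli : LinearIndependent ℝ ![normalFormU σ 0, normalFormV 0] := by
      rw [LinearIndependent.pair_iff]
      intro r s hrs
      have h1 := congrArg (fun v : Space => v 0) hrs
      have h2 := congrArg (fun v : Space => v 1) hrs
      simp [normalFormU, normalFormV] at h1 h2
      exact ⟨h1, h2⟩
    rw [LinearIndependent.pair_iff]
    intro r s hrs
    exact LinearIndependent.pair_iff.1 hli r s (hinjΨ (by simpa [hφp] using hrs))
  · filter_upwards [hφ', hΨ, eventually_eventually_nhds.2 hFe, hfst, hsnd]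
      with q hq hqΨ hqF h1 h2 w
    have e : F =ᶠ[𝓝 q] Φ.symm ∘ (normalForm σ ∘ φ) := hqF
    rw [e.fderiv_eq, fderiv_comp q hqΨ.differentiableAt_top
      (((contDiff_normalForm σ).contDiffAt.comp q hq).differentiableAt_top),
      fderiv_comp q (contDiff_normalForm σ).contDiffAt.differentiableAt_top
        hq.differentiableAt_top]
    simp only [ContinuousLinearMap.comp_apply, fderiv_normalForm, map_add, map_smul, h1, h2, quad]
    rfl

lemma IsCuspidalLips.aEquivalent {F : Plane → Space} {p : Plane} (h : IsCuspidalLips F p) :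
    AEquivalent F p (normalForm 1) 0 := by
  have e : normalForm 1 = fun x : Plane =>
    !₂[x.1, 2 * x.2 ^ 3 + x.1 ^ 2 * x.2, 3 * x.2 ^ 4 + x.1 ^ 2 * x.2 ^ 2] := by
    ext x : 1; simp [normalForm]
  rwa [e]

lemma IsCuspidalBeaks.aEquivalent {F : Plane → Space} {p : Plane} (h : IsCuspidalBeaks F p) :
    AEquivalent F p (normalForm (-1)) 0 := by
  have e : normalForm (-1) = fun x : Plane =>
    !₂[x.1, 2 * x.2 ^ 3 - x.1 ^ 2 * x.2, 3 * x.2 ^ 4 - x.1 ^ 2 * x.2 ^ 2] := by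
    ext x : 1; simp [normalForm, sub_eq_add_neg]
  rwa [e]

/-- Near `p` the function `ρ` is `r + c (σ a² + 6 b²)` with `c ≠ 0` and `(a, b)` a local
coordinate system centred at `p`. -/
structure MorseForm (ρ : Plane → ℝ) (p : Plane) (r σ : ℝ) (a b c : Plane → ℝ) : Prop where
  smooth_a : ∀ᶠ q in 𝓝 p, ContDiffAt ℝ ∞ a q
  smooth_b : ∀ᶠ q in 𝓝 p, ContDiffAt ℝ ∞ b q
  smooth_c : ∀ᶠ q in 𝓝 p, ContDiffAt ℝ ∞ c q
  a_zero : a p = 0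
  b_zero : b p = 0
  c_ne_zero : c p ≠ 0
  jac_ne_zero : jac a b p ≠ 0
  eq : ∀ᶠ q in 𝓝 p, ρ q = r + c q * quad σ a b q

lemma contDiffAt_signedArea {U : Set Plane} {F n : Plane → Space} (h : IsUnitNormal U F n)
    {q : Plane} (hq : q ∈ U) : ContDiffAt ℝ ∞ (signedArea F n) q :=
  contDiffAt_det3 ((h.contDiffAt hq).fderiv_top.clm_apply contDiffAt_const)
    ((h.contDiffAt hq).fderiv_top.clm_apply contDiffAt_const) (h.contDiffAt_normal hq)

/-! ### Morse form of the radius of curvature, and vanishing of the second curvature -/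

section

variable {U : Set Plane} {f ν : Plane → Space} {κ₁ κ₂ : Plane → ℝ} {p : Plane} {t σ : ℝ}

lemma ArePrincipalCurvatures.one_sub_ne_zero (hκ : ArePrincipalCurvatures U f ν κ₁ κ₂)
    (hp : p ∈ U) (hκp : κ₁ p ≠ 0) (ht : t = 1 / κ₁ p) : 1 - t * κ₂ p ≠ 0 := by
  intro h
  apply hκ.no_umbilic p hp
  rw [ht] at h
  field_simp at h
  linarith

/-- The signed area of `f^t` is computed twice, from the principal curvatures and from the
factorized differential. The comparison needs `det3 X Y ν ≠ 0` at `p`, that is, both `X` and `Y`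
orthogonal to `ν` there. -/
lemma exists_morseForm (hf : IsRegularSurface U f ν)
    (hκ : ArePrincipalCurvatures U f ν κ₁ κ₂) (hp : p ∈ U) (hκp : κ₁ p ≠ 0)
    (ht : t = 1 / κ₁ p) (hσ : σ ≠ 0)
    (h : AEquivalent (parallelSurface f ν t) p (normalForm σ) 0) :
    ∃ a b c, MorseForm (fun q => (κ₁ q)⁻¹) p t σ a b c ∧
      ∀ w, fderiv ℝ ν p w = -κ₁ p • fderiv ℝ f p w → fderiv ℝ a p w = 0 := by
  have hF := hf.parallelSurface t
  obtain ⟨a, b, X, Y, ha, hb, hX, hY, ha0, hb0, hj, hXY, hd⟩ :=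
    h.exists_fderiv_eq (hF.contDiffAt hp).continuousAt
  have hUp : ∀ᶠ q in 𝓝 p, q ∈ U := hf.isOpen.mem_nhds hp
  have hjc := contDiffAt_jac ha.self_of_nhds hb.self_of_nhds
  have hfr := (eventually_frequently_quad_ne_zero hσ ha hb hj).self_of_nhds
  have hq0 : quad σ a b p = 0 := by simp [quad, ha0, hb0]
  have hYν : inner ℝ (Y p) (ν p) = 0 := by
    by_contra hne
    have hcont : ContinuousAt (fun q => inner ℝ (Y q) (ν q)) p :=
      (hY.self_of_nhds.inner ℝ (hf.contDiffAt_normal hp)).continuousAt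
    refine hfr ?_
    filter_upwards [hcont.eventually_ne hne, hUp, hjc.continuousAt.eventually_ne hj, hd]
      with q hq hqU hqj hqd
    -- This test vector is killed by `da` and sent to the Jacobian by `db`, so it isolates `Y`. The
    -- resulting factor `quad` is nonzero at points accumulating at `p`, which is why a nonzero
    -- value of `⟨Y, ν⟩` at `p` is contradictory.
    have h1 := hF.orthogonal q hqU (-fderiv ℝ a q (0, 1), fderiv ℝ a q (1, 0))
    rw [hqd, clm_plane_apply (fderiv ℝ a q), clm_plane_apply (fderiv ℝ b q)] at h1
    simp only [inner_add_left, real_inner_smul_left, smul_eq_mul] at h1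
    have h2 : jac a b q * (quad σ a b q * inner ℝ (Y q) (ν q)) = 0 := by
      unfold jac
      linear_combination h1
    exact not_not.2 ((mul_eq_zero.1 ((mul_eq_zero.1 h2).resolve_left hqj)).resolve_right hq)
  have hXν : inner ℝ (X p) (ν p) = 0 := by
    have h1 := hF.orthogonal p hp (fderiv ℝ b p (0, 1), -fderiv ℝ b p (1, 0))
    rw [hd.self_of_nhds, hq0, clm_plane_apply (fderiv ℝ a p)] at h1
    simp only [inner_add_left, real_inner_smul_left, smul_eq_mul, mul_zero, zero_mul,
      add_zero] at h1
    refine (mul_eq_zero.1 (?_ : jac a b p * _ = 0)).resolve_left hj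
    unfold jac
    linear_combination h1
  have hD := det3_ne_zero_of_orthogonal (hf.norm_eq_one p hp) hXν hYν hXY
  have h2p := hκ.one_sub_ne_zero hp hκp ht
  have hAp := signedArea_ne_zero hf hp
  have hs1 : ∀ q ∈ U, ContDiffAt ℝ ∞ κ₁ q := fun q hq =>
    hκ.smooth₁.contDiffAt (hf.isOpen.mem_nhds hq)
  have hs2 : ∀ q ∈ U, ContDiffAt ℝ ∞ κ₂ q := fun q hq =>
    hκ.smooth₂.contDiffAt (hf.isOpen.mem_nhds hq)
  have hk1 : ∀ᶠ q in 𝓝 p, κ₁ q ≠ 0 := (hs1 p hp).continuousAt.eventually_ne hκp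
  have hk2 : ∀ᶠ q in 𝓝 p, (1 - t * κ₂ q) * signedArea f ν q ≠ 0 :=
    ContinuousAt.eventually_ne (((contDiffAt_const.sub (contDiffAt_const.mul (hs2 p hp))).mul
      (contDiffAt_signedArea hf.toIsUnitNormal hp)).continuousAt) (mul_ne_zero h2p hAp)
  -- The function `c` solves the two area formulas for `(κ₁)⁻¹ - t = (1 - tκ₁)/κ₁`.
  refine ⟨a, b, fun q => (κ₁ q)⁻¹ * (jac a b q * det3 (X q) (Y q) (ν q)) /
    ((1 - t * κ₂ q) * signedArea f ν q), ⟨ha, hb, ?_, ha0, hb0, ?_, hj, ?_⟩, ?_⟩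
  · filter_upwards [ha, hb, hX, hY, hUp, hk1, hk2] with q h1 h2 h3 h4 h5 h6 h7
    exact (((hs1 q h5).inv h6).mul ((contDiffAt_jac h1 h2).mul
      (contDiffAt_det3 h3 h4 (hf.contDiffAt_normal h5)))).div
      ((contDiffAt_const.sub (contDiffAt_const.mul (hs2 q h5))).mul
      (contDiffAt_signedArea hf.toIsUnitNormal h5)) h7
  · exact div_ne_zero (mul_ne_zero (inv_ne_zero hκp) (mul_ne_zero hj hD)) hk2.self_of_nhds
  · filter_upwards [hUp, hk1, hk2, hd] with q hqU hq1 hq2 hqd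
    have h1 := signedArea_parallelSurface hf hκ t hqU
    have h2 : signedArea (parallelSurface f ν t) ν q =
        jac a b q * quad σ a b q * det3 (X q) (Y q) (ν q) := by
      unfold signedArea du dv
      rw [hqd, hqd, det3_comb]
      unfold jac
      ring
    rw [h2] at h1
    have h3 : (1 - t * κ₁ q) * ((1 - t * κ₂ q) * signedArea f ν q) =
        jac a b q * quad σ a b q * det3 (X q) (Y q) (ν q) := by rw [h1]; ring
    generalize (1 - t * κ₂ q) * signedArea f ν q = A at h3 hq2 ⊢
    field_simp
    linear_combination h3
  -- Since `t = 1/κ₁(p)`, such a `w` lies in the kernel of the differential of `f^t` at `p`, which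
  -- there is `da X`.
  · intro w hw
    have h1 : fderiv ℝ (parallelSurface f ν t) p w = 0 := by
      rw [hf.fderiv_parallelSurface hp, add_apply, smul_apply, hw, smul_smul, ht]
      field_simp
      simp
    rw [hd.self_of_nhds, hq0, mul_zero, zero_smul, add_zero] at h1
    exact (smul_eq_zero.1 h1).resolve_right (hXY.ne_zero 0)

/-- The parallel surface is regular where the quadratic function does not vanish, and its
curvature there is the expected quotient. -/
lemma MorseForm.eventually_curvature {a b c : Plane → ℝ}
    (hm : MorseForm (fun q => (κ₁ q)⁻¹) p t σ a b c) (hf : IsRegularSurface U f ν)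
    (hκ : ArePrincipalCurvatures U f ν κ₁ κ₂) (hp : p ∈ U) (hκp : κ₁ p ≠ 0)
    (ht : t = 1 / κ₁ p) :
    ∀ᶠ q in 𝓝 p, quad σ a b q ≠ 0 → q ∈ U \ singularSet (parallelSurface f ν t) ∧
      (1 - t * κ₁ q) * (1 - t * κ₂ q) ≠ 0 ∧
      gaussianCurvature (parallelSurface f ν t) ν q =
        κ₁ q * κ₂ q / ((1 - t * κ₁ q) * (1 - t * κ₂ q)) := by
  have hs1 := hκ.smooth₁.contDiffAt (hf.isOpen.mem_nhds hp)
  have hs2 := hκ.smooth₂.contDiffAt (hf.isOpen.mem_nhds hp)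
  have hk2 : ∀ᶠ q in 𝓝 p, 1 - t * κ₂ q ≠ 0 :=
    ContinuousAt.eventually_ne (contDiffAt_const.sub (contDiffAt_const.mul hs2)).continuousAt
      (hκ.one_sub_ne_zero hp hκp ht)
  filter_upwards [hf.isOpen.mem_nhds hp, hs1.continuousAt.eventually_ne hκp, hk2, hm.eq,
    hm.smooth_c.self_of_nhds.continuousAt.eventually_ne hm.c_ne_zero] with q hq h1 h2 h3 h4 h5
  have h6 : 1 - t * κ₁ q = κ₁ q * (c q * quad σ a b q) := by
    have := mul_inv_cancel₀ h1
    rw [h3] at this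
    linear_combination -this
  have h7 : (1 - t * κ₁ q) * (1 - t * κ₂ q) ≠ 0 := by
    rw [h6]; exact mul_ne_zero (mul_ne_zero h1 (mul_ne_zero h4 h5)) h2
  exact ⟨⟨hq, not_mem_singularSet_parallelSurface hf hκ t hq h7⟩, h7,
    gaussianCurvature_parallelSurface hf hκ t hq h7⟩

lemma MorseForm.second_curvature_eq_zero_of_boundedNear {a b c : Plane → ℝ} (hσ : σ ≠ 0)
    (hm : MorseForm (fun q => (κ₁ q)⁻¹) p t σ a b c) (hf : IsRegularSurface U f ν)
    (hκ : ArePrincipalCurvatures U f ν κ₁ κ₂) (hp : p ∈ U) (hκp : κ₁ p ≠ 0)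
    (ht : t = 1 / κ₁ p)
    (hb : BoundedNear (U \ singularSet (parallelSurface f ν t))
      (gaussianCurvature (parallelSurface f ν t) ν) p) : κ₂ p = 0 := by
  obtain ⟨C, hC⟩ := hb
  have hs1 := (hκ.smooth₁.contDiffAt (hf.isOpen.mem_nhds hp)).continuousAt
  have hs2 := (hκ.smooth₂.contDiffAt (hf.isOpen.mem_nhds hp)).continuousAt
  have hfr := (eventually_frequently_quad_ne_zero hσ hm.smooth_a hm.smooth_b
    hm.jac_ne_zero).self_of_nhds
  have hcont : ContinuousAt (fun q => C * |(1 - t * κ₁ q) * (1 - t * κ₂ q)| -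
      |κ₁ q * κ₂ q|) p := by fun_prop
  -- With denominators cleared, the bound holds at regular points accumulating at `p` and passes to
  -- `p` by continuity. There the factor `1 - tκ₁` vanishes, leaving `κ₁κ₂ = 0`.
  have h0 : 0 ≤ C * |(1 - t * κ₁ p) * (1 - t * κ₂ p)| - |κ₁ p * κ₂ p| := by
    by_contra hneg
    refine hfr ?_
    filter_upwards [hcont.eventually_lt continuousAt_const (not_le.1 hneg),
      hm.eventually_curvature hf hκ hp hκp ht, hC] with q h1 h2 h3 h4
    obtain ⟨h5, h6, h7⟩ := h2 h4
    have h8 := h3 h5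
    rw [h7, abs_div, div_le_iff₀ (abs_pos.2 h6)] at h8
    linarith
  have ht1 : 1 - t * κ₁ p = 0 := by rw [ht]; field_simp; simp
  rw [ht1, zero_mul, abs_zero, mul_zero, zero_sub, neg_nonneg, abs_nonpos_iff] at h0
  exact (mul_eq_zero.1 h0).resolve_left hκp

lemma MorseForm.second_curvature_eq_zero_of_rationallyBounded {a b c : Plane → ℝ}
    (hσ : σ ≠ 0)
    (hm : MorseForm (fun q => (κ₁ q)⁻¹) p t σ a b c) (hf : IsRegularSurface U f ν)
    (hκ : ArePrincipalCurvatures U f ν κ₁ κ₂) (hp : p ∈ U) (hκp : κ₁ p ≠ 0)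
    (ht : t = 1 / κ₁ p)
    (hb : RationallyBounded (U \ singularSet (parallelSurface f ν t))
      (gaussianCurvature (parallelSurface f ν t) ν) p) : κ₂ p = 0 := by
  by_contra hκ2
  obtain ⟨h₁, h₂, s₁, s₂, n₁, n₂, hK, ho₁, ho₂, hn⟩ := hb
  obtain rfl : n₁ = n₂ := by omega
  have hs1 : ∀ q ∈ U, ContDiffAt ℝ ∞ κ₁ q := fun q hq =>
    hκ.smooth₁.contDiffAt (hf.isOpen.mem_nhds hq)
  have hs2 : ∀ q ∈ U, ContDiffAt ℝ ∞ κ₂ q := fun q hq =>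
    hκ.smooth₂.contDiffAt (hf.isOpen.mem_nhds hq)
  have hUp : ∀ᶠ q in 𝓝 p, q ∈ U := hf.isOpen.mem_nhds hp
  have hk : ∀ᶠ q in 𝓝 p, κ₁ q * κ₂ q ≠ 0 :=
    ((hs1 p hp).mul (hs2 p hp)).continuousAt.eventually_ne (mul_ne_zero hκp hκ2)
  -- If `κ₂(p) ≠ 0`, then `1/K^t` extends to this smooth germ, which vanishes at `p`. Hence `h₂ =
  -- h₁u` has order greater than that of `h₁`.
  set u : Plane → ℝ := fun q => (1 - t * κ₁ q) * (1 - t * κ₂ q) / (κ₁ q * κ₂ q) with hu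
  have su : SmoothNear u p := by
    filter_upwards [hUp, hk] with q hq hq'
    exact ((contDiffAt_const.sub (contDiffAt_const.mul (hs1 q hq))).mul
      (contDiffAt_const.sub (contDiffAt_const.mul (hs2 q hq)))).div
      ((hs1 q hq).mul (hs2 q hq)) hq'
  have hup : u p = 0 := by
    have ht1 : 1 - t * κ₁ p = 0 := by rw [ht]; field_simp; simp
    simp [hu, ht1]
  have heq : ∀ᶠ q in 𝓝 p, h₂ q = h₁ q * u q := by
    filter_upwards [s₁, s₂, su, eventually_frequently_quad_ne_zero hσ hm.smooth_a hm.smooth_b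
      hm.jac_ne_zero, eventually_eventually_nhds.2
      (hK.and (hk.and (hm.eventually_curvature hf hκ hp hκp ht)))] with q c1 c2 c3 hfr hev
    -- The identity is known where `quad ≠ 0`; such points accumulate at `q`, so continuity extends
    -- it.
    by_contra hne
    have hcont : ContinuousAt (fun r => h₂ r - h₁ r * u r) q :=
      (c2.sub (c1.mul c3)).continuousAt
    refine hfr ?_
    filter_upwards [hcont.eventually_ne (sub_ne_zero.2 hne), hev] with r hr ⟨e1, e2, e3⟩ h4
    obtain ⟨h5, h6, h7⟩ := e3 h4
    obtain ⟨h8, h9⟩ := e1 h5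
    rw [h7, div_eq_div_iff h6 h8] at h9
    apply hr
    simp only [hu]
    rw [sub_eq_zero, mul_div_assoc', eq_div_iff e2]
    linear_combination h9
  have hg : toGerm s₂ = toGerm s₁ * toGerm su := Subtype.ext (Germ.coe_eq.2 heq)
  have hmem : toGerm su ∈ maxIdeal p := hup
  apply ho₂.2
  rw [hg, pow_succ]
  exact Ideal.mul_mem_mul ho₁.1 hmem

end

/-! ### Principal fields and the local frame of the focal surface -/

lemma hasFDerivAt_mul_of_eq_zero {k m : Plane → ℝ} {p : Plane} {m' : Plane →L[ℝ] ℝ}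
    (hk : DifferentiableAt ℝ k p) (hm : HasFDerivAt m m' p) (h0 : m p = 0) :
    HasFDerivAt (fun q => k q * m q) (k p • m') p := by
  refine (hk.hasFDerivAt.mul hm).congr_fderiv ?_
  simp [h0]

lemma contDiffAt_det2 {a b : Plane → Plane} {q : Plane} (ha : ContDiffAt ℝ ∞ a q)
    (hb : ContDiffAt ℝ ∞ b q) : ContDiffAt ℝ ∞ (fun x => det2 (a x) (b x)) q :=
  (ha.fst.mul hb.snd).sub (ha.snd.mul hb.fst)

/-- A smooth field of principal directions. -/
lemma exists_principal_field {U : Set Plane} {f ν : Plane → Space} {κ₁ κ₂ : Plane → ℝ}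
    (hf : IsRegularSurface U f ν) (hκ : ArePrincipalCurvatures U f ν κ₁ κ₂) {p : Plane}
    (hp : p ∈ U) : ∃ W : Plane → Plane, W p ≠ 0 ∧ ∀ᶠ q in 𝓝 p, ContDiffAt ℝ ∞ W q ∧
      fderiv ℝ ν q (W q) = -κ₁ q • fderiv ℝ f q (W q) := by
  obtain ⟨y, hy, hyk⟩ := hκ.principal₂ p hp
  set A : Plane → Plane →L[ℝ] Space := fun q => fderiv ℝ ν q + κ₁ q • fderiv ℝ f q with hA
  have hAs : ∀ q ∈ U, ContDiffAt ℝ ∞ A q := fun q hq =>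
    (hf.contDiffAt_normal hq).fderiv_top.add
      ((hκ.smooth₁.contDiffAt (hf.isOpen.mem_nhds hq)).smul (hf.contDiffAt hq).fderiv_top)
  have hAy : A p y ≠ 0 := by
    have : A p y = (κ₁ p - κ₂ p) • fderiv ℝ f p y := by
      simp [hA, hyk]; module
    rw [this]
    refine smul_ne_zero (sub_ne_zero.2 (hκ.no_umbilic p hp)) ?_
    rwa [Ne, map_eq_zero_iff _ (hf.immersion p hp)]
  -- This vector lies in the kernel of the linear form `x ↦ ⟨A q x, A p y⟩`, and the form is nonzero
  -- at `q = p` because `A p y ≠ 0`. As `A q` itself has a nontrivial kernel, its columns are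
  -- dependent and the vector is killed by `A q` as well.
  refine ⟨fun q => (inner ℝ (A q (0, 1)) (A p y), -inner ℝ (A q (1, 0)) (A p y)), ?_, ?_⟩
  · intro h
    apply hAy
    have h1 := congrArg Prod.fst h
    have h2 := congrArg Prod.snd h
    simp only [Prod.fst_zero, Prod.snd_zero, neg_eq_zero] at h1 h2
    rw [← inner_self_eq_zero (𝕜 := ℝ)]
    nth_rewrite 1 [clm_plane_apply (A p) y]
    rw [inner_add_left, real_inner_smul_left, real_inner_smul_left, h1, h2]
    ring
  · filter_upwards [hf.isOpen.mem_nhds hp] with q hq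
    constructor
    · exact (((hAs q hq).clm_apply contDiffAt_const).inner ℝ contDiffAt_const).prodMk
        (((hAs q hq).clm_apply contDiffAt_const).inner ℝ contDiffAt_const).neg
    · suffices h : A q (inner ℝ (A q (0, 1)) (A p y), -inner ℝ (A q (1, 0)) (A p y)) = 0 by
        rw [hA] at h
        simp only [add_apply, smul_apply] at h
        rw [neg_smul]
        exact eq_neg_of_add_eq_zero_left h
      obtain ⟨x, hx, hxk⟩ := hκ.principal₁ q hq
      have hAx : A q x = 0 := by simp [hA, hxk]
      rw [clm_plane_apply (A q)] at hAx ⊢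
      simp only
      generalize A q (1, 0) = e at *
      generalize A q (0, 1) = e' at *
      generalize A p y = z at *
      by_cases h2 : x.2 = 0
      · have h1 : x.1 ≠ 0 := fun h1 => hx (Prod.ext h1 h2)
        rw [h2, zero_smul, add_zero] at hAx
        rw [(smul_eq_zero.1 hAx).resolve_left h1]
        simp
      · have he : e' = (-(x.1 / x.2)) • e := by
          have : x.2 • e' = x.2 • ((-(x.1 / x.2)) • e) := by
            rw [smul_smul, show x.2 * -(x.1 / x.2) = -x.1 by field_simp, neg_smul]
            exact eq_neg_of_add_eq_zero_right hAx
          exact smul_right_injective _ h2 this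
        rw [he, real_inner_smul_left]
        module

/-- Every term keeps an explicit factor `a` or `b`, which vanishes at `p`, so one further derivative
at `p` only sees the cofactors' values. -/
lemma MorseForm.fderiv_eq {ρ a b c : Plane → ℝ} {p : Plane} {r σ : ℝ}
    (h : MorseForm ρ p r σ a b c) : ∀ᶠ q in 𝓝 p, ∀ x, fderiv ℝ ρ q x =
      (σ * fderiv ℝ c q x * a q + 2 * σ * c q * fderiv ℝ a q x) * a q +
        (6 * fderiv ℝ c q x * b q + 12 * c q * fderiv ℝ b q x) * b q := by
  filter_upwards [h.smooth_a, h.smooth_b, h.smooth_c, eventually_eventually_nhds.2 h.eq]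
    with q ha hb hc he x
  have h1 := (hc.differentiableAt_top.hasFDerivAt.mul
    (hasFDerivAt_quad σ ha.differentiableAt_top hb.differentiableAt_top)).const_add r
  have h2 : fderiv ℝ ρ q = _ := (EventuallyEq.fderiv_eq he).trans h1.fderiv
  rw [h2]
  simp [quad]
  ring

/-- The local situation at a cuspidal lips or beaks of a parallel surface: a field `W` of
principal directions for the curvature `κ`, an asymptotic principal vector `y` at `p`, and the
Morse form of the radius of curvature `κ⁻¹`. -/
structure FocalFrame (U : Set Plane) (f ν : Plane → Space) (κ : Plane → ℝ) (p : Plane)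
    (W : Plane → Plane) (y : Plane) (r σ : ℝ) (a b c : Plane → ℝ) : Prop where
  regular : IsRegularSurface U f ν
  mem : p ∈ U
  smooth_curvature : ContDiffOn ℝ ∞ κ U
  curvature_ne_zero : κ p ≠ 0
  field_ne_zero : W p ≠ 0
  smooth_field : ∀ᶠ q in 𝓝 p, ContDiffAt ℝ ∞ W q
  principal : ∀ᶠ q in 𝓝 p, fderiv ℝ ν q (W q) = -κ q • fderiv ℝ f q (W q)
  det_ne_zero : det2 (W p) y ≠ 0
  orthogonal : inner ℝ (fderiv ℝ f p (W p)) (fderiv ℝ f p y) = 0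
  flat : fderiv ℝ ν p y = 0
  morse : MorseForm (fun q => (κ q)⁻¹) p r σ a b c
  fderiv_a_field : fderiv ℝ a p (W p) = 0

/-- The derivative of the radius of curvature along the principal field. -/
noncomputable def radialDeriv (κ : Plane → ℝ) (W : Plane → Plane) (q : Plane) : ℝ :=
  fderiv ℝ (fun x => (κ x)⁻¹) q (W q)

/-! ### Differential, singular set, normal and acceleration on the focal surface -/

namespace FocalFrame

variable {U : Set Plane} {f ν : Plane → Space} {κ : Plane → ℝ} {p : Plane}
    {W : Plane → Plane} {y : Plane} {r σ : ℝ} {a b c : Plane → ℝ}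

lemma eventually_mem (h : FocalFrame U f ν κ p W y r σ a b c) :
    ∀ᶠ q in 𝓝 p, q ∈ U ∧ ContDiffAt ℝ ∞ (fun x => (κ x)⁻¹) q := by
  have hs : ∀ q ∈ U, ContDiffAt ℝ ∞ κ q := fun q hq =>
    h.smooth_curvature.contDiffAt (h.regular.isOpen.mem_nhds hq)
  filter_upwards [h.regular.isOpen.mem_nhds h.mem,
    (hs p h.mem).continuousAt.eventually_ne h.curvature_ne_zero] with q hq hq'
  exact ⟨hq, (hs q hq).inv hq'⟩

lemma contDiffAt_focalSurface (h : FocalFrame U f ν κ p W y r σ a b c) :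
    ∀ᶠ q in 𝓝 p, ContDiffAt ℝ ∞ (focalSurface f ν κ) q :=
  h.eventually_mem.mono fun _ hq =>
    (h.regular.contDiffAt hq.1).add (hq.2.smul (h.regular.contDiffAt_normal hq.1))

lemma fderiv_focalSurface (h : FocalFrame U f ν κ p W y r σ a b c) :
    ∀ᶠ q in 𝓝 p, ∀ x, fderiv ℝ (focalSurface f ν κ) q x =
      fderiv ℝ f q x + (κ q)⁻¹ • fderiv ℝ ν q x +
        fderiv ℝ (fun x => (κ x)⁻¹) q x • ν q := by
  filter_upwards [h.eventually_mem] with q ⟨hq, hκ⟩ x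
  have h1 := (h.regular.contDiffAt hq).differentiableAt_top.hasFDerivAt.add
    (hκ.differentiableAt_top.hasFDerivAt.smul
      (h.regular.contDiffAt_normal hq).differentiableAt_top.hasFDerivAt)
  refine (congrArg (fun L : Plane →L[ℝ] Space => L x) h1.fderiv).trans ?_
  simp [add_assoc]

lemma inner_fderiv_focalSurface (h : FocalFrame U f ν κ p W y r σ a b c) :
    ∀ᶠ q in 𝓝 p, ∀ x, inner ℝ (fderiv ℝ (focalSurface f ν κ) q x) (ν q) =
      fderiv ℝ (fun x => (κ x)⁻¹) q x := by
  filter_upwards [h.fderiv_focalSurface, h.eventually_mem] with q hq hq' x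
  rw [hq, inner_add_left, inner_add_left, real_inner_smul_left, real_inner_smul_left,
    h.regular.orthogonal q hq'.1, h.regular.inner_fderiv_normal hq'.1,
    real_inner_self_eq_norm_sq, h.regular.norm_eq_one q hq'.1]
  ring

/-- Rodrigues' equation cancels the tangential part `df(W) + κ⁻¹ dν(W)`, leaving only the change of
radius. -/
lemma fderiv_focalSurface_field (h : FocalFrame U f ν κ p W y r σ a b c) :
    ∀ᶠ q in 𝓝 p, fderiv ℝ (focalSurface f ν κ) q (W q) = radialDeriv κ W q • ν q := by
  have hk := (h.smooth_curvature.contDiffAt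
    (h.regular.isOpen.mem_nhds h.mem)).continuousAt.eventually_ne h.curvature_ne_zero
  filter_upwards [h.fderiv_focalSurface, h.principal, hk] with q hq hq' hk
  rw [hq, hq', smul_smul, show (κ q)⁻¹ * -κ q = -1 by field_simp, radialDeriv]
  module

lemma fderiv_radius_eq_zero (h : FocalFrame U f ν κ p W y r σ a b c) (x : Plane) :
    fderiv ℝ (fun x => (κ x)⁻¹) p x = 0 := by
  rw [h.morse.fderiv_eq.self_of_nhds, h.morse.a_zero, h.morse.b_zero]
  ring

lemma fderiv_focalSurface_flat (h : FocalFrame U f ν κ p W y r σ a b c) :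
    fderiv ℝ (focalSurface f ν κ) p y = fderiv ℝ f p y := by
  rw [h.fderiv_focalSurface.self_of_nhds, h.fderiv_radius_eq_zero, h.flat]
  simp

lemma radialDeriv_eq_zero (h : FocalFrame U f ν κ p W y r σ a b c) : radialDeriv κ W p = 0 :=
  h.fderiv_radius_eq_zero _

lemma flat_ne_zero (h : FocalFrame U f ν κ p W y r σ a b c) : fderiv ℝ f p y ≠ 0 := by
  rw [Ne, map_eq_zero_iff _ (h.regular.immersion p h.mem)]
  rintro rfl
  exact h.det_ne_zero (by simp [det2])

lemma fderiv_b_field_ne_zero (h : FocalFrame U f ν κ p W y r σ a b c) :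
    fderiv ℝ b p (W p) ≠ 0 := fun hb =>
  h.field_ne_zero (eq_zero_of_jac_ne_zero h.morse.jac_ne_zero h.fderiv_a_field hb)

lemma contDiffAt_radialDeriv (h : FocalFrame U f ν κ p W y r σ a b c) :
    ∀ᶠ q in 𝓝 p, ContDiffAt ℝ ∞ (radialDeriv κ W) q := by
  filter_upwards [h.eventually_mem, h.smooth_field] with q hq hW
  exact hq.2.fderiv_top.clm_apply hW

lemma hasFDerivAt_radialDeriv (h : FocalFrame U f ν κ p W y r σ a b c) :
    HasFDerivAt (radialDeriv κ W) ((12 * c p * fderiv ℝ b p (W p)) • fderiv ℝ b p) p := by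
  have ha := h.morse.smooth_a.self_of_nhds
  have hb := h.morse.smooth_b.self_of_nhds
  have hc := h.morse.smooth_c.self_of_nhds
  have hW := h.smooth_field.self_of_nhds
  have hda := (ha.fderiv_top.clm_apply hW).differentiableAt_top
  have hdb := (hb.fderiv_top.clm_apply hW).differentiableAt_top
  have hdc := (hc.fderiv_top.clm_apply hW).differentiableAt_top
  have ha := ha.differentiableAt_top
  have hb := hb.differentiableAt_top
  have hc := hc.differentiableAt_top
  have h1 := (hasFDerivAt_mul_of_eq_zero (k := fun q => σ * fderiv ℝ c q (W q) * a q +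
    2 * σ * c q * fderiv ℝ a q (W q)) (by fun_prop) ha.hasFDerivAt h.morse.a_zero).add
    (hasFDerivAt_mul_of_eq_zero (k := fun q => 6 * fderiv ℝ c q (W q) * b q +
    12 * c q * fderiv ℝ b q (W q)) (by fun_prop) hb.hasFDerivAt h.morse.b_zero)
  have e : radialDeriv κ W =ᶠ[𝓝 p] _ := h.morse.fderiv_eq.mono fun q hq => hq (W q)
  refine (h1.congr_of_eventuallyEq e).congr_fderiv ?_
  simp [h.morse.a_zero, h.morse.b_zero, h.fderiv_a_field]

/-- If `Wρ ≠ 0`, then `dC₁(W)` is a nonzero multiple of `ν`, whereas `dC₁(y)` has the tangential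
part `df(y) + ρ dν(y)`. That part equals `df(y) ≠ 0` at `p`, so it stays nonzero nearby and the two
images are independent. -/
lemma radialDeriv_eq_zero_of_mem_singularSet (h : FocalFrame U f ν κ p W y r σ a b c) :
    ∀ᶠ q in 𝓝 p, q ∈ singularSet (focalSurface f ν κ) → radialDeriv κ W q = 0 := by
  have hdet : ∀ᶠ q in 𝓝 p, det2 (W q) y ≠ 0 :=
    (contDiffAt_det2 h.smooth_field.self_of_nhds contDiffAt_const).continuousAt.eventually_ne
      h.det_ne_zero
  have hT : ∀ᶠ q in 𝓝 p, fderiv ℝ f q y + (κ q)⁻¹ • fderiv ℝ ν q y ≠ 0 := by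
    have hs : ContDiffAt ℝ ∞ (fun q => fderiv ℝ f q y + (κ q)⁻¹ • fderiv ℝ ν q y) p :=
      ((h.regular.contDiffAt h.mem).fderiv_top.clm_apply contDiffAt_const).add
        (h.eventually_mem.self_of_nhds.2.smul
          ((h.regular.contDiffAt_normal h.mem).fderiv_top.clm_apply contDiffAt_const))
    refine hs.continuousAt.eventually_ne ?_
    rw [h.flat, smul_zero, add_zero]
    exact h.flat_ne_zero
  filter_upwards [hdet, hT, h.fderiv_focalSurface, h.fderiv_focalSurface_field,
    h.eventually_mem] with q h1 h2 h3 h4 h5 hq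
  by_contra hg
  refine hq ((injective_iff_map_eq_zero _).2 fun x hx => ?_)
  obtain ⟨s, s', rfl⟩ := exists_comb_of_det2_ne_zero h1 x
  rw [map_add, map_smul, map_smul, h4, h3] at hx
  set T := fderiv ℝ f q y + (κ q)⁻¹ • fderiv ℝ ν q y
  have hTν : inner ℝ (ν q) T = 0 := by
    rw [inner_add_right, real_inner_smul_right, real_inner_comm,
      h.regular.orthogonal q h5.1, real_inner_comm, h.regular.inner_fderiv_normal h5.1]
    ring
  have h6 := congrArg (fun v => inner ℝ v T) hx
  simp only [inner_add_left, real_inner_smul_left, smul_add, hTν, inner_zero_left, mul_zero,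
    zero_add, add_zero] at h6
  have hs' : s' = 0 := (mul_eq_zero.1 h6).resolve_right (inner_self_ne_zero.2 h2)
  rw [hs', zero_smul, add_zero, smul_smul] at hx
  have hν : ν q ≠ 0 := fun h0 => by simpa [h0] using h.regular.norm_eq_one q h5.1
  have hs := (mul_eq_zero.1 ((smul_eq_zero.1 hx).resolve_right hν)).resolve_right hg
  simp [hs, hs']

/-- The derivative at `p` of the signed area density of the focal surface. -/
lemma fderiv_signedArea (h : FocalFrame U f ν κ p W y r σ a b c) {V : Set Plane}
    {n : Plane → Space} (hp : p ∈ V) (hn : IsUnitNormal V (focalSurface f ν κ) n) (x : Plane) :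
    det2 (W p) y * fderiv ℝ (signedArea (focalSurface f ν κ) n) p x =
      det3 (ν p) (fderiv ℝ f p y) (n p) * (12 * c p * fderiv ℝ b p (W p) * fderiv ℝ b p x) := by
  set C := focalSurface f ν κ with hC
  have hdet := (contDiffAt_det2 h.smooth_field.self_of_nhds
    (contDiffAt_const (c := y))).differentiableAt_top
  have hl := (contDiffAt_signedArea hn hp).differentiableAt_top
  -- Evaluating the area density on `(W, y)` pulls out the factor `Wρ`. Both sides are products with
  -- a factor vanishing at `p`, so their derivatives there are immediate.
  have e : (fun q => det2 (W q) y * signedArea C n q) =ᶠ[𝓝 p]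
      fun q => det3 (ν q) (fderiv ℝ C q y) (n q) * radialDeriv κ W q := by
    filter_upwards [h.fderiv_focalSurface_field] with q hq
    unfold signedArea du dv
    rw [← det3_apply_comb, hq, ← one_smul ℝ (fderiv ℝ C q y), det3_smul, one_smul]
    ring
  have hl0 : signedArea C n p = 0 := by
    refine (mul_eq_zero.1 (e.eq_of_nhds.trans ?_)).resolve_left h.det_ne_zero
    rw [h.radialDeriv_eq_zero, mul_zero]
  have h1 := hasFDerivAt_mul_of_eq_zero hdet hl.hasFDerivAt hl0
  have h2 := hasFDerivAt_mul_of_eq_zero (contDiffAt_det3 (h.regular.contDiffAt_normal h.mem)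
    (h.contDiffAt_focalSurface.self_of_nhds.fderiv_top.clm_apply (contDiffAt_const (c := y)))
    (hn.contDiffAt_normal hp)).differentiableAt_top h.hasFDerivAt_radialDeriv
    h.radialDeriv_eq_zero
  have h3 := congrArg (fun L : Plane →L[ℝ] ℝ => L x) (h1.unique (h2.congr_of_eventuallyEq e))
  simp only [smul_apply, smul_eq_mul] at h3
  rw [h3, ← h.fderiv_focalSurface_flat]

/-- A unit normal of the focal surface is tangent to the surface at `p`. -/
lemma inner_normal (h : FocalFrame U f ν κ p W y r σ a b c) {V : Set Plane}
    {n : Plane → Space} (hp : p ∈ V) (hn : IsUnitNormal V (focalSurface f ν κ) n) :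
    inner ℝ (n p) (ν p) = 0 := by
  -- Orthogonality of `n` to `dC₁(W) = (Wρ)ν` says nothing at `p` itself, where `Wρ = 0`.
  -- Differentiating the product along `W` recovers it, since `W(Wρ) ≠ 0` at `p`.
  have e : (fun q => inner ℝ (n q) (ν q) * radialDeriv κ W q) =ᶠ[𝓝 p] fun _ => 0 := by
    filter_upwards [h.fderiv_focalSurface_field, hn.isOpen.mem_nhds hp] with q hq hqV
    have := hn.orthogonal q hqV (W q)
    rw [hq, real_inner_smul_left, real_inner_comm] at this
    rw [mul_comm, this]
  have h1 := hasFDerivAt_mul_of_eq_zero ((hn.contDiffAt_normal hp).inner ℝ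
    (h.regular.contDiffAt_normal h.mem)).differentiableAt_top h.hasFDerivAt_radialDeriv
    h.radialDeriv_eq_zero
  have h2 := congrArg (fun L : Plane →L[ℝ] ℝ => L (W p))
    (h1.unique ((hasFDerivAt_const (0 : ℝ) p).congr_of_eventuallyEq e))
  have h3 := h.fderiv_b_field_ne_zero
  have h4 := h.morse.c_ne_zero
  simpa [h3, h4] using h2

/-- The height of the acceleration of a curve on the focal surface. -/
lemma inner_deriv_deriv (h : FocalFrame U f ν κ p W y r σ a b c) {γ : ℝ → Plane}
    (hγ : ∀ᶠ s in 𝓝 (0 : ℝ), ContDiffAt ℝ ∞ γ s) (h0 : γ 0 = p) {s s' : ℝ}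
    (hs : deriv γ 0 = s • W p + s' • y) (hb : fderiv ℝ b p (deriv γ 0) = 0) :
    inner ℝ (deriv (deriv (focalSurface f ν κ ∘ γ)) 0) (ν p) =
      2 * σ * c p * fderiv ℝ a p (deriv γ 0) ^ 2 := by
  set C := focalSurface f ν κ with hC
  have hγ0 := hγ.self_of_nhds
  have hγc : Tendsto γ (𝓝 0) (𝓝 p) := h0 ▸ hγ0.continuousAt.tendsto
  have hcs : ∀ᶠ s in 𝓝 (0 : ℝ), deriv (C ∘ γ) s = fderiv ℝ C (γ s) (deriv γ s) := by
    filter_upwards [hγ, hγc.eventually h.contDiffAt_focalSurface] with s h1 h2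
    exact (h2.differentiableAt_top.hasFDerivAt.comp_hasDerivAt s
      h1.differentiableAt_top.hasDerivAt).deriv
  have hdγ : HasDerivAt γ (deriv γ 0) 0 := hγ0.differentiableAt_top.hasDerivAt
  have hγ' : ContDiffAt ℝ ∞ (deriv γ) 0 := by
    have : deriv γ = fun s => fderiv ℝ γ s 1 := by ext s : 1; simp
    rw [this]
    exact hγ0.fderiv_top.clm_apply contDiffAt_const
  have hcomp : ∀ {E : Type} [NormedAddCommGroup E] [NormedSpace ℝ E] {m : Plane → E},
      ContDiffAt ℝ ∞ m p → ContDiffAt ℝ ∞ (fun s => m (γ s)) 0 := fun hm =>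
    ContDiffAt.comp (0 : ℝ) (by rwa [h0]) hγ0
  have hd : HasDerivAt (deriv (C ∘ γ)) (deriv (deriv (C ∘ γ)) 0) 0 := by
    have h1 := (hcomp h.contDiffAt_focalSurface.self_of_nhds.fderiv_top).clm_apply hγ'
    exact (h1.differentiableAt_top.congr_of_eventuallyEq hcs).hasDerivAt
  have hν : HasDerivAt (fun s => ν (γ s)) (fderiv ℝ ν p (deriv γ 0)) 0 := by
    have h1 : HasFDerivAt ν (fderiv ℝ ν p) (γ 0) := by
      rw [h0]; exact (h.regular.contDiffAt_normal h.mem).differentiableAt_top.hasFDerivAt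
    exact h1.comp_hasDerivAt 0 hdγ
  -- The velocity is a multiple of `df(y)`; by symmetry of the second fundamental form the pairing
  -- then involves only `dν(y) = 0`.
  have hzero : inner ℝ (deriv (C ∘ γ) 0) (fderiv ℝ ν p (deriv γ 0)) = 0 := by
    rw [hcs.self_of_nhds, h0, hs, map_add, map_smul, map_smul,
      h.fderiv_focalSurface_field.self_of_nhds, h.radialDeriv_eq_zero, zero_smul, smul_zero,
      zero_add, h.fderiv_focalSurface_flat, real_inner_smul_left,
      h.regular.inner_fderiv_symm h.mem, h.flat, inner_zero_right, mul_zero]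
  -- The function `⟨(C₁ ∘ γ)', ν⟩` equals `dρ(γ')`; its derivative at `0` is computed here
  -- geometrically and in `hM` from the Morse form.
  have hR : HasDerivAt (fun s => inner ℝ (deriv (C ∘ γ) s) (ν (γ s)))
      (inner ℝ (deriv (deriv (C ∘ γ)) 0) (ν p)) 0 := by
    have h1 := hd.inner ℝ hν
    rwa [hzero, zero_add, h0] at h1
  have ha := h.morse.smooth_a.self_of_nhds
  have hb' := h.morse.smooth_b.self_of_nhds
  have hc := h.morse.smooth_c.self_of_nhds
  have d1 := (hcomp ha).differentiableAt_top
  have d2 := (hcomp hb').differentiableAt_top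
  have d3 := (hcomp hc).differentiableAt_top
  have d4 := ((hcomp ha.fderiv_top).clm_apply hγ').differentiableAt_top
  have d5 := ((hcomp hb'.fderiv_top).clm_apply hγ').differentiableAt_top
  have d6 := ((hcomp hc.fderiv_top).clm_apply hγ').differentiableAt_top
  have e1 : HasDerivAt (fun s => a (γ s)) (fderiv ℝ a p (deriv γ 0)) 0 := by
    have h1 : HasFDerivAt a (fderiv ℝ a p) (γ 0) := by
      rw [h0]; exact ha.differentiableAt_top.hasFDerivAt
    exact h1.comp_hasDerivAt 0 hdγ
  have e2 : HasDerivAt (fun s => b (γ s)) (fderiv ℝ b p (deriv γ 0)) 0 := by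
    have h1 : HasFDerivAt b (fderiv ℝ b p) (γ 0) := by
      rw [h0]; exact hb'.differentiableAt_top.hasFDerivAt
    exact h1.comp_hasDerivAt 0 hdγ
  have k1 : DifferentiableAt ℝ (fun s => σ * fderiv ℝ c (γ s) (deriv γ s) * a (γ s) +
    2 * σ * c (γ s) * fderiv ℝ a (γ s) (deriv γ s)) 0 :=
    ((d6.const_mul σ).mul d1).add ((d3.const_mul (2 * σ)).mul d4)
  have k2 : DifferentiableAt ℝ (fun s => 6 * fderiv ℝ c (γ s) (deriv γ s) * b (γ s) +
    12 * c (γ s) * fderiv ℝ b (γ s) (deriv γ s)) 0 :=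
    ((d6.const_mul 6).mul d2).add ((d3.const_mul 12).mul d5)
  have hM := (k1.hasDerivAt.mul e1).add (k2.hasDerivAt.mul e2)
  refine hR.unique ((hM.congr_of_eventuallyEq ?_).congr_deriv ?_)
  · filter_upwards [hcs, hγc.eventually h.inner_fderiv_focalSurface,
      hγc.eventually h.morse.fderiv_eq] with s h1 h2 h3
    rw [h1, h2, h3]
    rfl
  · simp only [h0, h.morse.a_zero, h.morse.b_zero, hb]
    ring

end FocalFrame

/-! ### Regular zero curves by the inverse function theorem, and a sign lemma -/

lemma exists_equiv_of_injective {L : Plane →L[ℝ] Plane} (hL : Function.Injective L) :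
    ∃ e : Plane ≃L[ℝ] Plane, (e : Plane →L[ℝ] Plane) = L :=
  ⟨(LinearEquiv.ofInjectiveEndo L.toLinearMap hL).toContinuousLinearEquiv, by ext <;> rfl⟩

lemma eventually_injective_fderiv {E : Type*} [NormedAddCommGroup E] [NormedSpace ℝ E]
    {F : Plane → E} {p : Plane} (hF : ContDiffAt ℝ ∞ F p)
    (hinj : Function.Injective (fderiv ℝ F p)) :
    ∀ᶠ q in 𝓝 p, Function.Injective (fderiv ℝ F q) :=
  hF.fderiv_top.continuousAt.eventually_mem
    (ContinuousLinearMap.isOpen_injective.mem_nhds hinj)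

/-- A regular zero of a smooth function lies on a smooth regular curve of zeros. -/
lemma exists_curve_of_zeros {g : Plane → ℝ} {p w : Plane}
    (hg : ∀ᶠ q in 𝓝 p, ContDiffAt ℝ ∞ g q) (h0 : g p = 0) (hw : fderiv ℝ g p w ≠ 0) :
    ∃ γ : ℝ → Plane, (∀ᶠ s in 𝓝 (0 : ℝ), ContDiffAt ℝ ∞ γ s) ∧ γ 0 = p ∧ deriv γ 0 ≠ 0 ∧
      ∀ᶠ s in 𝓝 (0 : ℝ), g (γ s) = 0 := by
  -- The second component has kernel spanned by `w`, on which `dg` is nonzero, so `dψ` is injective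
  -- at `p`. The curve is the preimage of the second axis under `ψ`.
  set ψ : Plane → Plane := fun q => (g q, det2 w (q - p)) with hψ
  have hψs : ∀ᶠ q in 𝓝 p, ContDiffAt ℝ ∞ ψ q := by
    filter_upwards [hg] with q hq
    exact hq.prodMk (contDiffAt_det2 contDiffAt_const (contDiffAt_id.sub contDiffAt_const))
  have hψp : ψ p = 0 := by simp [hψ, h0, det2]
  have hdψ : HasFDerivAt ψ ((fderiv ℝ g p).prod (w.1 • ContinuousLinearMap.snd ℝ ℝ ℝ -
      w.2 • ContinuousLinearMap.fst ℝ ℝ ℝ)) p := by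
    refine hg.self_of_nhds.differentiableAt_top.hasFDerivAt.prodMk ?_
    set l := w.1 • ContinuousLinearMap.snd ℝ ℝ ℝ - w.2 • ContinuousLinearMap.fst ℝ ℝ ℝ with hl
    refine (l.hasFDerivAt.sub_const (l p)).congr_of_eventuallyEq (Eventually.of_forall fun q => ?_)
    simp only [hl, det2, sub_apply, smul_apply, ContinuousLinearMap.coe_fst',
      ContinuousLinearMap.coe_snd', smul_eq_mul, Prod.fst_sub, Prod.snd_sub]
    ring
  have hw0 : w ≠ 0 := by rintro rfl; simp at hw
  have hinj : Function.Injective (fderiv ℝ ψ p) := by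
    rw [hdψ.fderiv, injective_iff_map_eq_zero]
    intro x hx
    simp only [ContinuousLinearMap.prod_apply, Prod.mk_eq_zero, sub_apply,
      smul_apply, ContinuousLinearMap.coe_fst', ContinuousLinearMap.coe_snd',
      smul_eq_mul] at hx
    obtain ⟨s, rfl⟩ := exists_smul_of_det2_eq_zero hw0 (b := x) (by unfold det2; exact hx.2)
    have h1 := hx.1
    rw [map_smul, smul_eq_mul] at h1
    rw [(mul_eq_zero.1 h1).resolve_right hw, zero_smul]
  obtain ⟨e, he⟩ := exists_equiv_of_injective hinj
  have hs0 := hψs.self_of_nhds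
  have hfe : HasFDerivAt ψ (e : Plane →L[ℝ] Plane) p := by
    rw [he]; exact hs0.differentiableAt_top.hasFDerivAt
  set H := hs0.toOpenPartialHomeomorph ψ hfe (by simp) with hH
  have hHc : ⇑H = ψ := rfl
  have hpH : p ∈ H.source := hs0.mem_toOpenPartialHomeomorph_source hfe (by simp)
  have h0H : (0 : Plane) ∈ H.target := by
    rw [← hψp]; exact hs0.image_mem_toOpenPartialHomeomorph_target hfe (by simp)
  have hsymm0 : H.symm 0 = p := by
    have := H.left_inv hpH
    rwa [hHc, hψp] at this
  -- Smoothness of the inverse is needed on a neighbourhood, so invertibility of `dψ` is propagated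
  -- from `p` to nearby points.
  have hsm : ∀ᶠ x in 𝓝 (0 : Plane), ContDiffAt ℝ ∞ H.symm x := by
    have hc : Tendsto H.symm (𝓝 0) (𝓝 p) := by
      have := H.continuousAt_symm h0H
      rwa [ContinuousAt, hsymm0] at this
    filter_upwards [hc.eventually hψs, hc.eventually (eventually_injective_fderiv hs0 hinj),
      H.open_target.mem_nhds h0H] with x h1 h2 h3
    obtain ⟨e', he'⟩ := exists_equiv_of_injective h2
    refine H.contDiffAt_symm h3 (f₀' := e') ?_ h1
    rw [he']
    exact h1.differentiableAt_top.hasFDerivAt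
  have hcl : Tendsto (fun s : ℝ => ((0, s) : Plane)) (𝓝 0) (𝓝 0) :=
    Continuous.tendsto' (by fun_prop) _ _ rfl
  have hγs : ∀ᶠ s in 𝓝 (0 : ℝ), ContDiffAt ℝ ∞ (fun s : ℝ => H.symm (0, s)) s := by
    filter_upwards [hcl.eventually hsm] with s hs
    exact ContDiffAt.comp s hs (contDiffAt_const.prodMk contDiffAt_id)
  have hinv : ∀ᶠ s in 𝓝 (0 : ℝ), ψ (H.symm (0, s)) = (0, s) := by
    filter_upwards [hcl.eventually (H.open_target.mem_nhds h0H)] with s hs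
    exact H.right_inv hs
  refine ⟨fun s => H.symm (0, s), hγs, hsymm0, fun hd => ?_,
    hinv.mono fun s hs => congrArg Prod.fst hs⟩
  have h1 : HasDerivAt (fun s : ℝ => H.symm (0, s)) 0 0 := by
    rw [← hd]; exact hγs.self_of_nhds.differentiableAt_top.hasDerivAt
  have h2 : HasFDerivAt ψ (fderiv ℝ ψ p) (H.symm (0, 0)) := by
    rw [show H.symm (0, 0) = p from hsymm0]; exact hs0.differentiableAt_top.hasFDerivAt
  have h3 := h2.comp_hasDerivAt (0 : ℝ) h1
  have h4 : HasDerivAt (fun s : ℝ => ((0, s) : Plane)) (0, 1) 0 :=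
    (hasDerivAt_const 0 0).prodMk (hasDerivAt_id 0)
  have h5 := h3.unique (h4.congr_of_eventuallyEq hinv)
  simpa using congrArg Prod.snd h5

/-- Replacing `sign x` by `x` and dropping `z` only changes the expression by the positive factor
`|x| z`. -/
lemma sign_mul_pos {x y z s : ℝ} (hz : 0 < z) (h : 0 < s * (x * y)) :
    0 < s * (Real.sign x * (y / z)) := by
  have hx : x ≠ 0 := by rintro rfl; simp at h
  have e : s * (x * y) = (s * (Real.sign x * (y / z))) * (|x| * z) := by
    have : Real.sign x * |x| = x := by
      rcases lt_or_gt_of_ne hx with hx | hx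
      · rw [Real.sign_of_neg hx, abs_of_neg hx]; ring
      · rw [Real.sign_of_pos hx, abs_of_pos hx]; ring
    field_simp
    linear_combination (-(s * y)) * this
  rw [e] at h
  exact pos_of_mul_pos_left h (by positivity)

/-! ### Sign and existence of the singular curvature -/

namespace FocalFrame

variable {U : Set Plane} {f ν : Plane → Space} {κ : Plane → ℝ} {p : Plane}
    {W : Plane → Plane} {y : Plane} {r σ : ℝ} {a b c : Plane → ℝ}

/-- The sign of the singular curvature of the focal surface is the sign of `σ`. -/
lemma singularCurvature_pos (h : FocalFrame U f ν κ p W y r σ a b c) (hσ : σ ≠ 0)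
    {n : Plane → Space} {γ : ℝ → Plane} {η : Plane → Plane}
    (hd : IsSingularData (focalSurface f ν κ) p n γ η) :
    0 < σ * singularCurvature (focalSurface f ν κ) n γ η := by
  obtain ⟨V, hpV, hV⟩ := hd.front
  have h0 := hd.curve_zero
  have hγ0 := hd.curve_smooth.self_of_nhds
  have hγc : Tendsto γ (𝓝 0) (𝓝 p) := h0 ▸ hγ0.continuousAt.tendsto
  have htr := hd.transverse
  have hreg := hd.curve_regular
  have hη : fderiv ℝ (focalSurface f ν κ) p (η p) = 0 :=
    hd.null.self_of_nhds (h0 ▸ hd.curve_singular.self_of_nhds)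
  unfold singularCurvature
  rw [h0] at htr ⊢
  have hbW := h.fderiv_b_field_ne_zero
  have hc := h.morse.c_ne_zero
  have hdet := h.det_ne_zero
  have hbv : fderiv ℝ b p (deriv γ 0) = 0 := by
    have h1 : (fun s => radialDeriv κ W (γ s)) =ᶠ[𝓝 0] fun _ => 0 := by
      filter_upwards [hd.curve_singular, hγc.eventually h.radialDeriv_eq_zero_of_mem_singularSet]
        with s h1 h2 using h2 h1
    have h2 := h.hasFDerivAt_radialDeriv
    rw [← h0] at h2
    have h3 := (h2.comp_hasDerivAt (0 : ℝ) hγ0.differentiableAt_top.hasDerivAt).unique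
      ((hasDerivAt_const (0 : ℝ) (0 : ℝ)).congr_of_eventuallyEq h1)
    rw [h0] at h3
    simpa [hbW, hc] using h3
  have hav : fderiv ℝ a p (deriv γ 0) ≠ 0 := fun ha =>
    hreg (eq_zero_of_jac_ne_zero h.morse.jac_ne_zero ha hbv)
  obtain ⟨s, s', hv⟩ := exists_comb_of_det2_ne_zero hdet (deriv γ 0)
  obtain ⟨k, k', hk⟩ := exists_comb_of_det2_ne_zero hdet (η p)
  have hs' : s' ≠ 0 := by
    rintro rfl
    apply hav
    rw [hv, zero_smul, add_zero, map_smul, h.fderiv_a_field, smul_zero]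
  have hdC : ∀ i j : ℝ, fderiv ℝ (focalSurface f ν κ) p (i • W p + j • y) =
      j • fderiv ℝ f p y := fun i j => by
    rw [map_add, map_smul, map_smul, h.fderiv_focalSurface_field.self_of_nhds,
      h.radialDeriv_eq_zero, zero_smul, smul_zero, zero_add, h.fderiv_focalSurface_flat]
  -- At `p` the kernel of `dC₁` is spanned by `W`, so any null field is a multiple of `W` there.
  have hk' : k' = 0 := by
    rw [hk, hdC] at hη
    exact (smul_eq_zero.1 hη).resolve_right h.flat_ne_zero
  rw [hk', zero_smul, add_zero] at hk
  have hc' : deriv (focalSurface f ν κ ∘ γ) 0 = s' • fderiv ℝ f p y := by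
    have h1 : HasFDerivAt (focalSurface f ν κ) (fderiv ℝ (focalSurface f ν κ) p) (γ 0) := by
      rw [h0]; exact h.contDiffAt_focalSurface.self_of_nhds.differentiableAt_top.hasFDerivAt
    rw [(h1.comp_hasDerivAt (0 : ℝ) hγ0.differentiableAt_top.hasDerivAt).deriv, hv, hdC]
  have hacc := h.inner_deriv_deriv hd.curve_smooth h0 hv hbv
  have hnν := h.inner_normal hpV hV.toIsUnitNormal
  have hl := h.fderiv_signedArea hpV hV.toIsUnitNormal (W p)
  set D := det3 (ν p) (fderiv ℝ f p y) (n p) with hD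
  set l := fderiv ℝ (signedArea (focalSurface f ν κ) n) p (W p) with hldef
  have hlη : fderiv ℝ (signedArea (focalSurface f ν κ) n) p (η p) = k * l := by
    rw [hk, map_smul, smul_eq_mul]
  rw [hlη] at htr ⊢
  have hk0 := left_ne_zero_of_mul htr
  have hl0 := right_ne_zero_of_mul htr
  have hD0 : D ≠ 0 := by
    intro hD0
    rw [hD0, zero_mul] at hl
    exact hl0 ((mul_eq_zero.1 hl).resolve_left hdet)
  have hnum : det3 (deriv (focalSurface f ν κ ∘ γ) 0)
      (deriv (deriv (focalSurface f ν κ ∘ γ)) 0) (n p) =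
      -(2 * σ * c p * fderiv ℝ a p (deriv γ 0) ^ 2 * (s' * D)) := by
    rw [det3_eq_of_orthogonal _ (h.regular.norm_eq_one p h.mem) _ hnν, hacc, hc',
      ← one_smul ℝ (ν p), det3_smul, one_mul]
    rw [hc', real_inner_smul_left, h.regular.orthogonal p h.mem, mul_zero]
  have hdet2 : det2 (deriv γ 0) (η p) = -(s' * k * det2 (W p) y) := by
    rw [hk, hv]
    simp only [det2, Prod.fst_add, Prod.snd_add, Prod.smul_fst, Prod.smul_snd, smul_eq_mul]
    ring
  have hnorm : 0 < ‖deriv (focalSurface f ν κ ∘ γ) 0‖ := by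
    rw [hc', norm_pos_iff]
    exact smul_ne_zero hs' h.flat_ne_zero
  refine sign_mul_pos (by positivity) ?_
  rw [hnum, hdet2]
  -- Multiplying by `σ` and substituting `hl` for `det2 (W p) y * l` turns everything into a perfect
  -- square; `24` is the `2` of the acceleration times the `12` of the area derivative. Thus the
  -- choices of `n`, `γ`, `η` do not affect the sign.
  have e : σ * (k * l * -(s' * k * det2 (W p) y) *
      -(2 * σ * c p * fderiv ℝ a p (deriv γ 0) ^ 2 * (s' * D))) =
      24 * (σ * k * s' * c p * D * fderiv ℝ a p (deriv γ 0) * fderiv ℝ b p (W p)) ^ 2 := by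
    linear_combination (2 * σ ^ 2 * k ^ 2 * s' ^ 2 * c p * D *
      fderiv ℝ a p (deriv γ 0) ^ 2) * hl
  rw [e]
  positivity

/-- The singular curvature of the focal surface is defined. -/
lemma exists_isSingularData (h : FocalFrame U f ν κ p W y r σ a b c) :
    ∃ n γ η, IsSingularData (focalSurface f ν κ) p n γ η := by
  have hgW : fderiv ℝ (radialDeriv κ W) p (W p) ≠ 0 := by
    rw [h.hasFDerivAt_radialDeriv.fderiv]
    simp [h.fderiv_b_field_ne_zero, h.morse.c_ne_zero]
  obtain ⟨γ, hγs, hγ0, hγd, hγz⟩ :=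
    exists_curve_of_zeros h.contDiffAt_radialDeriv h.radialDeriv_eq_zero hgW
  have hWne : ∀ᶠ q in 𝓝 p, W q ≠ 0 :=
    h.smooth_field.self_of_nhds.continuousAt.eventually_ne h.field_ne_zero
  set X : Plane → Space := fun q => fderiv ℝ f q (W q) with hX
  -- The normal of the focal surface is the unit vector along the first principal direction.
  set n : Plane → Space := fun q => ‖X q‖⁻¹ • X q with hn
  have hXs : ∀ᶠ q in 𝓝 p, ContDiffAt ℝ ∞ X q := by
    filter_upwards [h.eventually_mem, h.smooth_field] with q hq hW
    exact (h.regular.contDiffAt hq.1).fderiv_top.clm_apply hW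
  have hXne : ∀ᶠ q in 𝓝 p, X q ≠ 0 := by
    filter_upwards [h.eventually_mem, hWne] with q hq hW
    rwa [hX, Ne, map_eq_zero_iff _ (h.regular.immersion q hq.1)]
  have hns : ∀ᶠ q in 𝓝 p, ContDiffAt ℝ ∞ n q := by
    filter_upwards [hXs, hXne] with q h1 h2
    exact ((h1.norm ℝ h2).inv (norm_ne_zero_iff.2 h2)).smul h1
  have hnν : ∀ᶠ q in 𝓝 p, inner ℝ (n q) (ν q) = 0 := by
    filter_upwards [h.eventually_mem] with q hq
    rw [hn, real_inner_smul_left, h.regular.orthogonal q hq.1, mul_zero]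
  have hC := h.contDiffAt_focalSurface
  have horth : ∀ᶠ q in 𝓝 p, ∀ w, inner ℝ (fderiv ℝ (focalSurface f ν κ) q w) (n q) = 0 := by
    have hk := (h.smooth_curvature.contDiffAt
      (h.regular.isOpen.mem_nhds h.mem)).continuousAt.eventually_ne h.curvature_ne_zero
    filter_upwards [h.fderiv_focalSurface, h.principal, h.eventually_mem, hnν, hk]
      with q h1 h2 h3 h4 h5 w
    -- By symmetry `⟨dν(w), df(W)⟩ = -κ⟨df(w), df(W)⟩`, so multiplying by `κ⁻¹` cancels the first
    -- term of `⟨dC₁(w), df(W)⟩`.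
    have h6 := h.regular.inner_fderiv_symm h3.1 w (W q)
    rw [h2, real_inner_smul_right] at h6
    rw [h1, inner_add_left, real_inner_smul_left, real_inner_comm (n q) (ν q), h4, hn, mul_zero,
      add_zero, real_inner_smul_right, inner_add_left, real_inner_smul_left,
      real_inner_comm (X q) (fderiv ℝ ν q w), ← h6]
    field_simp
    simp [hX]
  have hXp : X p ≠ 0 := hXne.self_of_nhds
  have hinj : Function.Injective (fderiv ℝ (fun x => (focalSurface f ν κ x, n x)) p) := by
    have hCd := hC.self_of_nhds.differentiableAt_top
    have hnd := hns.self_of_nhds.differentiableAt_top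
    rw [hCd.fderiv_prodMk hnd, injective_iff_map_eq_zero]
    intro x hx
    obtain ⟨s, s', rfl⟩ := exists_comb_of_det2_ne_zero h.det_ne_zero x
    simp only [ContinuousLinearMap.prod_apply, Prod.mk_eq_zero] at hx
    obtain ⟨hx1, hx2⟩ := hx
    rw [map_add, map_smul, map_smul, h.fderiv_focalSurface_field.self_of_nhds,
      h.radialDeriv_eq_zero, zero_smul, smul_zero, zero_add, h.fderiv_focalSurface_flat] at hx1
    have hs' := (smul_eq_zero.1 hx1).resolve_right h.flat_ne_zero
    rw [hs', zero_smul, add_zero, map_smul] at hx2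
    -- Only multiples of `W` are left in the kernel of `dC₁`. Differentiating `⟨n, ν⟩ = 0` along `W`
    -- gives `⟨dn(W), ν⟩ = κ⟨n, df(W)⟩ ≠ 0`, so `dn(W) ≠ 0` at `p`.
    have h1 : (fun q => inner ℝ (n q) (ν q)) =ᶠ[𝓝 p] fun _ => (0 : ℝ) := hnν
    have h2 := congrArg (fun L : Plane →L[ℝ] ℝ => L (W p)) h1.fderiv_eq
    rw [fderiv_inner_apply ℝ hnd (h.regular.contDiffAt_normal h.mem).differentiableAt_top,
      h.principal.self_of_nhds, real_inner_smul_right] at h2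
    simp only [fderiv_fun_const, Pi.zero_apply, zero_apply] at h2
    have hs : s = 0 := by
      by_contra hs
      rw [(smul_eq_zero.1 hx2).resolve_left hs, inner_zero_left, add_zero] at h2
      have h3 := (mul_eq_zero.1 h2).resolve_left (neg_ne_zero.2 h.curvature_ne_zero)
      rw [hn, real_inner_smul_left] at h3
      exact mul_ne_zero (inv_ne_zero (norm_ne_zero_iff.2 hXp)) (inner_self_ne_zero.2 hXp) h3
    rw [hs, hs', zero_smul, zero_smul, add_zero]
  have hev := (hC.and hns).and (hXne.and (horth.and
    (eventually_injective_fderiv (hC.self_of_nhds.prodMk hns.self_of_nhds) hinj)))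
  obtain ⟨V, hV, hVo, hpV⟩ := mem_nhds_iff.1 hev
  have hfront : IsFront V (focalSurface f ν κ) n :=
    { isOpen := hVo
      smooth := fun q hq => (hV hq).1.1.contDiffWithinAt
      smooth_normal := fun q hq => (hV hq).1.2.contDiffWithinAt
      norm_eq_one := fun q hq => by
        have hne := norm_ne_zero_iff.2 (hV hq).2.1
        rw [hn, norm_smul, norm_inv, norm_norm, inv_mul_cancel₀ hne]
      orthogonal := fun q hq => (hV hq).2.2.1
      immersion := fun q hq => (hV hq).2.2.2 }
  refine ⟨n, γ, W, ⟨V, hpV, hfront⟩, hγs, hγ0, hγd, ?_, h.smooth_field, hWne, ?_, ?_⟩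
  · have hγc : Tendsto γ (𝓝 0) (𝓝 p) := hγ0 ▸ hγs.self_of_nhds.continuousAt.tendsto
    filter_upwards [hγz, hγc.eventually h.fderiv_focalSurface_field, hγc.eventually hWne]
      with s h1 h2 h3 hinj'
    rw [h1, zero_smul, map_eq_zero_iff _ hinj'] at h2
    exact h3 h2
  · filter_upwards [h.fderiv_focalSurface_field, h.radialDeriv_eq_zero_of_mem_singularSet]
      with q h1 h2 hq
    rw [h1, h2 hq, zero_smul]
  · rw [hγ0]
    have hl := h.fderiv_signedArea hpV hfront.toIsUnitNormal (W p)
    intro hl0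
    rw [hl0, mul_zero] at hl
    have hne : 12 * c p * fderiv ℝ b p (W p) * fderiv ℝ b p (W p) ≠ 0 := by
      have := h.fderiv_b_field_ne_zero
      have := h.morse.c_ne_zero
      positivity
    have hD := (mul_eq_zero.1 hl.symm).resolve_right hne
    -- The three vectors are pairwise orthogonal and two are unit, so the squared determinant is
    -- `|df(y)|²`, which is nonzero.
    have hsq := det3_sq (ν p) (fderiv ℝ f p y) (n p)
    have e1 : inner ℝ (ν p) (ν p) = (1 : ℝ) := by
      rw [real_inner_self_eq_norm_sq, h.regular.norm_eq_one p h.mem]; norm_num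
    have e2 : inner ℝ (n p) (n p) = (1 : ℝ) := by
      rw [real_inner_self_eq_norm_sq, hfront.norm_eq_one p hpV]; norm_num
    have e3 : inner ℝ (ν p) (fderiv ℝ f p y) = (0 : ℝ) := by
      rw [real_inner_comm, h.regular.orthogonal p h.mem]
    have e4 : inner ℝ (fderiv ℝ f p y) (n p) = (0 : ℝ) := by
      rw [hn, real_inner_smul_right, real_inner_comm, h.orthogonal, mul_zero]
    have e5 : inner ℝ (ν p) (n p) = (0 : ℝ) := by
      rw [real_inner_comm, hnν.self_of_nhds]
    rw [hD, e1, e2, e3, e4, e5] at hsq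
    apply h.flat_ne_zero
    rw [← inner_self_eq_zero (𝕜 := ℝ)]
    linarith

end FocalFrame

/-! ### Assembly for lips and beaks -/

section

variable {U : Set Plane} {f ν : Plane → Space} {κ₁ κ₂ : Plane → ℝ} {p : Plane} {t σ : ℝ}

/-- If `f + t ν` is equivalent to a normal form and its Gaussian curvature is (rationally)
bounded, the singular curvature of the focal surface is defined and has the sign of `σ`. -/
lemma singularCurvature_focalSurface (hf : IsRegularSurface U f ν)
    (hκ : ArePrincipalCurvatures U f ν κ₁ κ₂) (hp : p ∈ U) (hκp : κ₁ p ≠ 0)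
    (ht : t = 1 / κ₁ p) (hσ : σ ≠ 0)
    (h : AEquivalent (parallelSurface f ν t) p (normalForm σ) 0)
    (hK : RationallyBounded (U \ singularSet (parallelSurface f ν t))
        (gaussianCurvature (parallelSurface f ν t) ν) p ∨
      BoundedNear (U \ singularSet (parallelSurface f ν t))
        (gaussianCurvature (parallelSurface f ν t) ν) p) :
    (∃ n γ η, IsSingularData (focalSurface f ν κ₁) p n γ η) ∧
      ∀ n γ η, IsSingularData (focalSurface f ν κ₁) p n γ η →
        0 < σ * singularCurvature (focalSurface f ν κ₁) n γ η := by
  obtain ⟨a, b, c, hm, haW⟩ := exists_morseForm hf hκ hp hκp ht hσ h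
  have hκ2 : κ₂ p = 0 := hK.elim
    (hm.second_curvature_eq_zero_of_rationallyBounded hσ hf hκ hp hκp ht)
    (hm.second_curvature_eq_zero_of_boundedNear hσ hf hκ hp hκp ht)
  obtain ⟨W, hW0, hW⟩ := exists_principal_field hf hκ hp
  obtain ⟨y, hy, hyk⟩ := hκ.principal₂ p hp
  obtain ⟨ho, hdet⟩ := hf.principal_basis hp (hκ.no_umbilic p hp) hW0 hy hW.self_of_nhds.2 hyk
  have hF : FocalFrame U f ν κ₁ p W y t σ a b c :=
    { regular := hf
      mem := hp
      smooth_curvature := hκ.smooth₁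
      curvature_ne_zero := hκp
      field_ne_zero := hW0
      smooth_field := hW.mono fun _ hq => hq.1
      principal := hW.mono fun _ hq => hq.2
      det_ne_zero := hdet
      orthogonal := ho
      flat := by rw [hyk, hκ2, neg_zero, zero_smul]
      morse := hm
      fderiv_a_field := haW _ hW.self_of_nhds.2 }
  exact ⟨hF.exists_isSingularData, fun n γ η hd => hF.singularCurvature_pos hσ hd⟩

lemma singularCurvaturePos_focalSurface (hf : IsRegularSurface U f ν)
    (hκ : ArePrincipalCurvatures U f ν κ₁ κ₂) (hp : p ∈ U) (hκp : κ₁ p ≠ 0)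
    (ht : t = 1 / κ₁ p) (h : IsCuspidalLips (parallelSurface f ν t) p)
    (hK : RationallyBounded (U \ singularSet (parallelSurface f ν t))
        (gaussianCurvature (parallelSurface f ν t) ν) p ∨
      BoundedNear (U \ singularSet (parallelSurface f ν t))
        (gaussianCurvature (parallelSurface f ν t) ν) p) :
    SingularCurvaturePos (focalSurface f ν κ₁) p := by
  have := singularCurvature_focalSurface hf hκ hp hκp ht one_ne_zero h.aEquivalent hK
  exact ⟨this.1, fun n γ η hd => by simpa using this.2 n γ η hd⟩

lemma singularCurvatureNeg_focalSurface (hf : IsRegularSurface U f ν)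
    (hκ : ArePrincipalCurvatures U f ν κ₁ κ₂) (hp : p ∈ U) (hκp : κ₁ p ≠ 0)
    (ht : t = 1 / κ₁ p) (h : IsCuspidalBeaks (parallelSurface f ν t) p)
    (hK : RationallyBounded (U \ singularSet (parallelSurface f ν t))
        (gaussianCurvature (parallelSurface f ν t) ν) p ∨
      BoundedNear (U \ singularSet (parallelSurface f ν t))
        (gaussianCurvature (parallelSurface f ν t) ν) p) :
    SingularCurvatureNeg (focalSurface f ν κ₁) p := by
  have := singularCurvature_focalSurface hf hκ hp hκp ht (by norm_num : (-1 : ℝ) ≠ 0)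
    h.aEquivalent hK
  exact ⟨this.1, fun n γ η hd => by simpa using this.2 n γ η hd⟩

end

end FocalSurface

theorem mainTheorem8 (U : Set FocalSurface.Plane)
    (f ν : FocalSurface.Plane → FocalSurface.Space) (κ₁ κ₂ : FocalSurface.Plane → ℝ)
    (hf : FocalSurface.IsRegularSurface U f ν)
    (hκ : FocalSurface.ArePrincipalCurvatures U f ν κ₁ κ₂)
    (p : FocalSurface.Plane) (hp : p ∈ U) (hκp : κ₁ p ≠ 0)
    (t : ℝ) (ht : t = 1 / κ₁ p)
    (ft : FocalSurface.Plane → FocalSurface.Space)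
    (hft : ft = FocalSurface.parallelSurface f ν t)
    (Kt : FocalSurface.Plane → ℝ) (hKt : Kt = FocalSurface.gaussianCurvature ft ν)
    (C₁ : FocalSurface.Plane → FocalSurface.Space)
    (hC₁ : C₁ = FocalSurface.focalSurface f ν κ₁) :
    (FocalSurface.IsCuspidalLips ft p →
      (FocalSurface.RationallyBounded (U \ FocalSurface.singularSet ft) Kt p →
        FocalSurface.SingularCurvaturePos C₁ p) ∧
      (FocalSurface.BoundedNear (U \ FocalSurface.singularSet ft) Kt p →
        FocalSurface.SingularCurvaturePos C₁ p)) ∧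
    (FocalSurface.IsCuspidalBeaks ft p →
      (FocalSurface.RationallyBounded (U \ FocalSurface.singularSet ft) Kt p →
        FocalSurface.SingularCurvatureNeg C₁ p) ∧
      (FocalSurface.BoundedNear (U \ FocalSurface.singularSet ft) Kt p →
        FocalSurface.SingularCurvatureNeg C₁ p)) := by
  subst hft hKt hC₁
  exact ⟨fun h =>
    ⟨fun hK => FocalSurface.singularCurvaturePos_focalSurface hf hκ hp hκp ht h (Or.inl hK),
      fun hK => FocalSurface.singularCurvaturePos_focalSurface hf hκ hp hκp ht h (Or.inr hK)⟩,
    fun h =>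
    ⟨fun hK => FocalSurface.singularCurvatureNeg_focalSurface hf hκ hp hκp ht h (Or.inl hK),
      fun hK => FocalSurface.singularCurvatureNeg_focalSurface hf hκ hp hκp ht h (Or.inr hK)⟩⟩
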